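/- Let $N\ge 2$, $1\le r\le N$, $T>0$, and $\hbar_N = 2/\sqrt{N^2-1}$, $[A,B]_N=\hbar_N^{-1}(AB-BA)$. Put $s=(N-1)/2$ and let $$(T^N_{\ell,m})_{m_1,m_2}=\sqrt{\tfrac{N}{4\pi}}\,(-1)^{s-m_1}\sqrt{2\ell+1}\begin{pmatrix} s&\ell&s\\ -m_1&m&m_2\end{pmatrix},\qquad m_1,m_2\in\{-s,-s+1,\dots,s\},$$ for $0\le\ell\le N-1$, $-\ell\le m\le \ell$ (Wigner 3j-symbols); these matrices form a basis of $\mathbb{C}^{N\times N}$, orthonormal for $\langle A,B\rangle_N=\frac{4\pi}{N}\operatorname{Tr}(A^*B)$. The quantized Laplacian $\Delta_N$ is the linear operator with $\Delta_N T^N_{\ell,m}=-\ell(\ell+1)T^N_{\ell,m}$; $\Delta_N^{-1}$ denotes its inverse on trace-free matrices, extended by $0$ to multiples of the identity matrix $I$. Let $X_H(A)=[A,\Delta_N^{-1}A]_N$. The Zeitlin model on $[0,T]$ is $$\dot W+[P,W]_N=0,\qquad \Delta_N P=W,$$ for $W(t)$ in the Lie algebra $\mathfrak{u}(N)$ of skew-Hermitian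 matrices, where the second equation is read modulo multiples of $I$, i.e. as $\Delta_N P=W-\frac{\operatorname{Tr}W}{N}I$ (this is $\Delta_NP=W$ when $W$ is in the trace-free subalgebra $\mathfrak{su}(N)$). For $A\in\mathbb{C}^{N\times N}$ let $\sigma_1(A)\ge\dots\ge\sigma_N(A)\ge 0$ be its singular values, and let $\mathrm{svd}_r(A)$ be a best approximation of $A$ in the Frobenius norm $\|\cdot\|_F$ among matrices of rank at most $r$ (the truncated singular value decomposition). Let $W_0\in\mathfrak{su}(N)$, and assume that $r=N$, or $\sigma_r(W_0)>\sigma_{r+1}(W_0)$, or $\sigma_{r+1}(W_0)=0$, so that $Y_0=\mathrm{svd}_r(W_0)$ is unique; it is then obtained by truncating an eigendecomposition of $W_0$ to the $r$ eigenvalues of largest modulus. Let $W$ and $Y$ be solutions of the Zeitlin model on $[0,T]$ with $W(0)=W_0$ and $Y(0)=Y_0$. Let $K>0$ be a Lipschitz constant of $X_H$, in the Frobenius norm, on the co-adjoint orbit $\{RY_0R^*: R\in U(N)\}$ of $Y_0$. Then, for every $t\in(0,T]$ and $\mathrm{svd}_r(W(t))$ the best rank-$r$ approximation of $W(t)$,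 $$\|Y(t)-\mathrm{svd}_r(W(t))\|_F\le \frac{\|\mathrm{svd}_r(W_0)\|_F}{\hbar_N K}\,\bigl(e^{Kt}-1\bigr)\Bigl(\sum_{i=r+1}^N\sigma_i^2(W_0)\Bigr)^{1/2}.$$ -/

import Mathlib

attribute [local instance] Matrix.frobeniusNormedAddCommGroup Matrix.frobeniusNormedSpace

namespace Zeitlin

noncomputable section

open scoped Matrix

/-- `1 / z!` for an integer `z ≥ 0`, and `0` for `z < 0`. -/
def invFactorial (z : ℤ) : ℝ :=
  if 0 ≤ z then 1 / (z.toNat.factorial : ℝ) else 0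

/-- The Wigner 3j-symbol `(a/2 b/2 c/2; α/2 β/2 γ/2)`, by Racah's formula.
The arguments are *twice* the (half-integer) spins `j₁, j₂, j₃` and *twice* the magnetic numbers
`m₁, m₂, m₃`, so that all of them are integers. The symbol vanishes unless `j₁ + j₂ + j₃` and all
`jᵢ + mᵢ` are integers, `m₁ + m₂ + m₃ = 0`, `|mᵢ| ≤ jᵢ`, and the triangle inequalities hold;
otherwise it is
`(-1)^(j₁ - j₂ - m₃)`
`* √((j₁+j₂-j₃)! (j₁-j₂+j₃)! (-j₁+j₂+j₃)! / (j₁+j₂+j₃+1)!) * √(∏ᵢ (jᵢ+mᵢ)! (jᵢ-mᵢ)!)`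
`* ∑ₖ (-1)^k / (k! (j₁+j₂-j₃-k)! (j₁-m₁-k)! (j₂+m₂-k)! (j₃-j₂+m₁+k)! (j₃-j₁-m₂+k)!)`. -/
def wigner3j (a b c α β γ : ℤ) : ℝ :=
  if Even (a + b + c) ∧ Even (a + α) ∧ Even (b + β) ∧ Even (c + γ) ∧
      α + β + γ = 0 ∧ |α| ≤ a ∧ |β| ≤ b ∧ |γ| ≤ c ∧ |a - b| ≤ c ∧ c ≤ a + b then
    (-1 : ℝ) ^ ((a - b - γ) / 2)
      * √(((((a + b - c) / 2).toNat.factorial * ((a - b + c) / 2).toNat.factorial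
            * ((-a + b + c) / 2).toNat.factorial : ℕ) : ℝ)
          / (((a + b + c) / 2 + 1).toNat.factorial : ℝ))
      * √(((((a + α) / 2).toNat.factorial * ((a - α) / 2).toNat.factorial
            * ((b + β) / 2).toNat.factorial * ((b - β) / 2).toNat.factorial
            * ((c + γ) / 2).toNat.factorial * ((c - γ) / 2).toNat.factorial : ℕ) : ℝ))
      * ∑ k ∈ Finset.range (((a + b - c) / 2).toNat + 1),
          (-1 : ℝ) ^ k * invFactorial k * invFactorial ((a + b - c) / 2 - k)
            * invFactorial ((a - α) / 2 - k) * invFactorial ((b + β) / 2 - k)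
            * invFactorial ((c - b + α) / 2 + k) * invFactorial ((c - a - β) / 2 + k)
  else 0

/-- The matrix `T^N_{ℓ,m}`, whose entry with row and column labels `m₁, m₂ ∈ {-s, -s+1, …, s}`,
`s = (N-1)/2`, is `√(N/4π) (-1)^(s-m₁) √(2ℓ+1) (s ℓ s; -m₁ m m₂)`.
The index `i : Fin N` stands for the label `m₁ = i - s`; thus `2 m₁ = 2 i - (N - 1)` and
`s - m₁ = N - 1 - i`. -/
def T (N ℓ : ℕ) (m : ℤ) : Matrix (Fin N) (Fin N) ℂ := fun i j =>
  ((√((N : ℝ) / (4 * Real.pi)) * (-1 : ℝ) ^ (N - 1 - (i : ℕ)) * √(2 * (ℓ : ℝ) + 1)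
    * wigner3j ((N : ℤ) - 1) (2 * (ℓ : ℤ)) ((N : ℤ) - 1)
        (-(2 * ((i : ℕ) : ℤ) - ((N : ℤ) - 1))) (2 * m) (2 * ((j : ℕ) : ℤ) - ((N : ℤ) - 1)) : ℝ) : ℂ)

/-- The scaled Frobenius inner product `⟨A, B⟩_N = (4π/N) Tr(A* B)`. -/
def innerN {N : ℕ} (A B : Matrix (Fin N) (Fin N) ℂ) : ℂ :=
  ((4 * Real.pi / (N : ℝ) : ℝ) : ℂ) * (Aᴴ * B).trace

/-- The linear operator that has the `⟨·,·⟩_N`-orthonormal basis `T^N_{ℓ,m}`, `0 ≤ ℓ ≤ N-1`,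
`-ℓ ≤ m ≤ ℓ`, as eigenvectors, with eigenvalues `f ℓ`. -/
def spectralOp (N : ℕ) (f : ℕ → ℝ) (A : Matrix (Fin N) (Fin N) ℂ) : Matrix (Fin N) (Fin N) ℂ :=
  ∑ ℓ ∈ Finset.range N, ∑ m ∈ Finset.Icc (-(ℓ : ℤ)) (ℓ : ℤ),
    ((f ℓ : ℂ) * innerN (T N ℓ m) A) • T N ℓ m

/-- The quantized Laplacian `Δ_N`: `Δ_N T^N_{ℓ,m} = -ℓ(ℓ+1) T^N_{ℓ,m}`. -/
def laplacian (N : ℕ) : Matrix (Fin N) (Fin N) ℂ → Matrix (Fin N) (Fin N) ℂ :=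
  spectralOp N fun ℓ => -((ℓ : ℝ) * (ℓ + 1))

/-- The inverse `Δ_N⁻¹` of the quantized Laplacian on trace-free matrices, extended by `0` to the
multiples of the identity matrix (the span of `T^N_{0,0}`, the kernel of `Δ_N`):
`Δ_N⁻¹ T^N_{ℓ,m} = -(ℓ(ℓ+1))⁻¹ T^N_{ℓ,m}` for `ℓ ≥ 1` and `Δ_N⁻¹ T^N_{0,0} = 0`. -/
def invLaplacian (N : ℕ) : Matrix (Fin N) (Fin N) ℂ → Matrix (Fin N) (Fin N) ℂ :=
  spectralOp N fun ℓ => if ℓ = 0 then 0 else -((ℓ : ℝ) * (ℓ + 1))⁻¹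

/-- `ħ_N = 2 / √(N² - 1)`. -/
def hbar (N : ℕ) : ℝ := 2 / √((N : ℝ) ^ 2 - 1)

/-- The scaled commutator `[A, B]_N = ħ_N⁻¹ (A B - B A)`. -/
def bracketN {N : ℕ} (A B : Matrix (Fin N) (Fin N) ℂ) : Matrix (Fin N) (Fin N) ℂ :=
  (hbar N)⁻¹ • (A * B - B * A)

/-- The Hamiltonian vector field `X_H(A) = [A, Δ_N⁻¹ A]_N` of the Zeitlin model. -/
def vectorField {N : ℕ} (A : Matrix (Fin N) (Fin N) ℂ) : Matrix (Fin N) (Fin N) ℂ :=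
  bracketN A (invLaplacian N A)

/-- The Lie algebra `𝔲(N)` of skew-Hermitian matrices. -/
def u (N : ℕ) : Set (Matrix (Fin N) (Fin N) ℂ) := {A | Aᴴ = -A}

/-- The Lie algebra `𝔰𝔲(N)` of trace-free skew-Hermitian matrices. -/
def su (N : ℕ) : Set (Matrix (Fin N) (Fin N) ℂ) := {A | Aᴴ = -A ∧ A.trace = 0}

/-- The co-adjoint orbit `{R A R* : R ∈ U(N)}`. -/
def orbit {N : ℕ} (A : Matrix (Fin N) (Fin N) ℂ) : Set (Matrix (Fin N) (Fin N) ℂ) :=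
  {B | ∃ R ∈ Matrix.unitaryGroup (Fin N) ℂ, B = R * A * Rᴴ}

/-- `W` solves, in `𝔲(N)` and on the time interval `[0, T]`, the Zeitlin model
`Ẇ + [P, W]_N = 0`, `Δ_N P = W`, with initial condition `W₀`.

On `𝔲(N)` the equation `Δ_N P = W` is understood modulo multiples of the identity matrix, that is,
for the trace-free part of `W` (this is `W` itself if `W ∈ 𝔰𝔲(N)`), since the range of `Δ_N`
consists of trace-free matrices. It determines `P` up to a multiple of the identity matrix, which
does not change `[P, W]_N`. -/
structure IsSolution {N : ℕ} (T : ℝ) (W : ℝ → Matrix (Fin N) (Fin N) ℂ)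
    (W₀ : Matrix (Fin N) (Fin N) ℂ) : Prop where
  initial : W 0 = W₀
  mem_u : ∀ t ∈ Set.Icc 0 T, W t ∈ u N
  equation : ∃ P : ℝ → Matrix (Fin N) (Fin N) ℂ, ∀ t ∈ Set.Icc 0 T,
    laplacian N (P t) = W t - ((W t).trace / (N : ℂ)) • (1 : Matrix (Fin N) (Fin N) ℂ) ∧
    HasDerivWithinAt W (-bracketN (P t) (W t)) (Set.Icc 0 T) t

/-- `B` is a best rank-`r` approximation of `A` in the Frobenius norm: it has rank at most `r` and
is at least as close to `A` as any other such matrix. -/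
def IsBestRankApprox {N : ℕ} (r : ℕ) (A B : Matrix (Fin N) (Fin N) ℂ) : Prop :=
  B.rank ≤ r ∧ ∀ C : Matrix (Fin N) (Fin N) ℂ, C.rank ≤ r → ‖A - B‖ ≤ ‖A - C‖

/-- The `i`-th largest singular value `σ_i(A)`, `i = 1, 2, …`, with multiplicity
(Mathlib numbers them from `0`); it is `0` for `i > N`. -/
def sigma {N : ℕ} (A : Matrix (Fin N) (Fin N) ℂ) (i : ℕ) : ℝ :=
  (Matrix.toEuclideanLin A).singularValues (i - 1)

end

end Zeitlin

namespace Zeitlin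

noncomputable section

open scoped Matrix Nat

/-! ### Orthogonality of the coefficients of `(1 - x)^l (1 + y)^l (1 + x y)^a` -/

/-- The binomial coefficient `l.choose z`, extended by `0` to integers `z < 0`. -/
def chooseInt (l : ℕ) (z : ℤ) : ℝ := if 0 ≤ z then (l.choose z.toNat : ℝ) else 0

lemma chooseInt_natCast (l k : ℕ) : chooseInt l k = l.choose k := by
  simp [chooseInt]

lemma chooseInt_of_neg (l : ℕ) {z : ℤ} (hz : z < 0) : chooseInt l z = 0 := by
  simp [chooseInt, hz]

lemma chooseInt_of_lt (l : ℕ) {z : ℤ} (hz : l < z) : chooseInt l z = 0 := by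
  lift z to ℕ using by omega
  rw [chooseInt_natCast, Nat.choose_eq_zero_of_lt (by omega), Nat.cast_zero]

lemma chooseInt_zero (z : ℤ) : chooseInt 0 z = if z = 0 then 1 else 0 := by
  rcases lt_trichotomy z 0 with hz | rfl | hz
  · rw [chooseInt_of_neg _ hz, if_neg hz.ne]
  · simp [chooseInt]
  · rw [chooseInt_of_lt _ (by simpa using hz), if_neg hz.ne']

lemma chooseInt_succ (l : ℕ) (z : ℤ) :
    chooseInt (l + 1) z = chooseInt l z + chooseInt l (z - 1) := by
  rcases lt_trichotomy z 0 with hz | rfl | hz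
  · simp [chooseInt_of_neg _ hz, chooseInt_of_neg _ (show z - 1 < 0 by omega)]
  · simp [chooseInt]
  · obtain ⟨k, rfl⟩ : ∃ k : ℕ, z = (k + 1 : ℕ) := ⟨(z - 1).toNat, by omega⟩
    rw [show (((k + 1 : ℕ) : ℤ) - 1) = (k : ℕ) by push_cast; ring]
    simp only [chooseInt_natCast, Nat.choose_succ_succ]
    push_cast; ring

lemma add_one_mul_chooseInt (l : ℕ) (z : ℤ) :
    ((z : ℝ) + 1) * chooseInt l (z + 1) = (l - z) * chooseInt l z := by
  rcases lt_trichotomy z (-1) with hz | rfl | hz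
  · simp [chooseInt_of_neg _ (show z < 0 by omega), chooseInt_of_neg _ (show z + 1 < 0 by omega)]
  · simp [chooseInt]
  · lift z to ℕ using by omega
    rw [show ((z : ℤ) + 1) = ((z + 1 : ℕ) : ℤ) by push_cast; ring]
    simp only [chooseInt_natCast]
    rcases le_or_gt z l with h | h
    · have := Nat.choose_succ_right_eq l z
      have h2 : ((l.choose (z + 1) * (z + 1) : ℕ) : ℝ) = (l.choose z * (l - z) : ℕ) := by rw [this]
      push_cast [Nat.cast_sub h] at h2 ⊢
      linarith
    · simp [Nat.choose_eq_zero_of_lt h, Nat.choose_eq_zero_of_lt (show l < z + 1 by omega)]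

/-- The coefficient of `x^i y^j` in `(1 - x)^l (1 + y)^l (1 + x y)^a`. -/
def genCoeff (l a : ℕ) (i j : ℤ) : ℝ :=
  ∑ k ∈ Finset.range (l + 1),
    (-1 : ℝ) ^ k * l.choose k * chooseInt l (j - i + k) * chooseInt a (i - k)

lemma genCoeff_zero (l : ℕ) (i j : ℤ) :
    genCoeff l 0 i j = (-1 : ℝ) ^ i * chooseInt l i * chooseInt l j := by
  unfold genCoeff
  by_cases hi : 0 ≤ i ∧ i ≤ l
  · obtain ⟨h0, h1⟩ := hi
    lift i to ℕ using h0
    rw [Finset.sum_eq_single i]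
    · simp [chooseInt_zero, chooseInt_natCast]
    · intro k _ hk
      rw [chooseInt_zero, if_neg (by omega), mul_zero]
    · intro h; simp at h; omega
  · rw [Finset.sum_eq_zero]
    · rcases lt_or_ge i 0 with h | h
      · simp [chooseInt_of_neg _ h]
      · simp [chooseInt_of_lt l (show (l : ℤ) < i by omega)]
    · intro k hk
      rw [Finset.mem_range] at hk
      rw [chooseInt_zero, if_neg (by omega), mul_zero]

lemma genCoeff_succ (l a : ℕ) (i j : ℤ) :
    genCoeff l (a + 1) i j = genCoeff l a i j + genCoeff l a (i - 1) (j - 1) := by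
  unfold genCoeff
  rw [← Finset.sum_add_distrib]
  refine Finset.sum_congr rfl fun k _ => ?_
  rw [chooseInt_succ, show j - 1 - (i - 1) + (k : ℤ) = j - i + k by ring,
    show i - 1 - (k : ℤ) = i - k - 1 by ring]
  ring

lemma genCoeff_eq_zero (l a : ℕ) (i j : ℤ) (h : i < 0 ∨ j < 0 ∨ l + a < i ∨ l + a < j) :
    genCoeff l a i j = 0 := by
  induction a generalizing i j with
  | zero =>
    rw [genCoeff_zero]
    rcases h with h | h | h | h
    · simp [chooseInt_of_neg _ h]
    · simp [chooseInt_of_neg _ h]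
    · simp [chooseInt_of_lt l (show (l : ℤ) < i by simpa using h)]
    · simp [chooseInt_of_lt l (show (l : ℤ) < j by simpa using h)]
  | succ a ih =>
    rw [genCoeff_succ, ih _ _ (by push_cast at h; omega), ih _ _ (by push_cast at h; omega), add_zero]

/-- The operator `∂_{x₀} ∂_{y₀} + ∂_x ∂_y` on coefficients of polynomials of bidegree `(n, n)`. -/
def lower (n : ℕ) (c : ℤ → ℤ → ℝ) (i j : ℤ) : ℝ :=
  (n - i) * (n - j) * c i j + (i + 1) * (j + 1) * c (i + 1) (j + 1)

lemma lower_genCoeff_zero (l : ℕ) (i j : ℤ) : lower l (genCoeff l 0) i j = 0 := by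
  simp only [lower, genCoeff_zero]
  have h1 := add_one_mul_chooseInt l i
  have h2 := add_one_mul_chooseInt l j
  rw [zpow_add₀ (by norm_num), zpow_one]
  linear_combination (-(-1 : ℝ) ^ i * (j + 1) * chooseInt l (j + 1)) * h1 -
    (-1 : ℝ) ^ i * (l - i) * chooseInt l i * h2

lemma lower_genCoeff_succ (l a : ℕ) (i j : ℤ) :
    lower (l + a + 1) (genCoeff l (a + 1)) i j =
      ((a + 1) * (a + 2 + 2 * l)) * genCoeff l a i j := by
  induction a generalizing i j with
  | zero =>
    have h1 := lower_genCoeff_zero l i j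
    have h2 := lower_genCoeff_zero l (i - 1) (j - 1)
    simp only [lower, genCoeff_succ, add_sub_cancel_right, sub_add_cancel] at h1 h2 ⊢
    push_cast at h1 h2 ⊢
    linear_combination h1 + h2
  | succ a ih =>
    have h1 := ih i j
    have h2 := ih (i - 1) (j - 1)
    have e := genCoeff_succ l a i j
    have e' := fun i j => genCoeff_succ l (a + 1) i j
    simp only [lower, e', add_sub_cancel_right, sub_add_cancel] at h1 h2 ⊢
    push_cast at h1 h2 ⊢
    linear_combination h1 + h2 - ((a : ℝ) + 1) * (a + 2 + 2 * l) * e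

/-- The weighted inner product of coefficients over the diagonal `i - j = m`. -/
def pairing (n : ℕ) (m : ℤ) (c d : ℤ → ℤ → ℝ) : ℝ :=
  ∑ i ∈ Finset.range (n + 1), ∑ j ∈ Finset.range (n + 1),
    if (i : ℤ) - j = m then
      (i ! * (n - i)! * (j ! * (n - j)!) : ℕ) * (c i j * d i j) else 0

lemma pairing_comm (n : ℕ) (m : ℤ) (c d : ℤ → ℤ → ℝ) : pairing n m c d = pairing n m d c := by
  simp only [pairing, mul_comm (c _ _)]

lemma sum_sum_range_succ_of_last_eq_zero {n : ℕ} {F : ℕ → ℕ → ℝ} (h1 : ∀ j, F n j = 0)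
    (h2 : ∀ i, F i n = 0) :
    ∑ i ∈ Finset.range (n + 1), ∑ j ∈ Finset.range (n + 1), F i j =
      ∑ i ∈ Finset.range n, ∑ j ∈ Finset.range n, F i j := by
  simp [Finset.sum_range_succ, h1, h2]

lemma sum_sum_range_succ_of_zero_eq_zero {n : ℕ} {F : ℕ → ℕ → ℝ} (h1 : ∀ j, F 0 j = 0)
    (h2 : ∀ i, F i 0 = 0) :
    ∑ i ∈ Finset.range (n + 1), ∑ j ∈ Finset.range (n + 1), F i j =
      ∑ i ∈ Finset.range n, ∑ j ∈ Finset.range n, F (i + 1) (j + 1) := by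
  simp [Finset.sum_range_succ', h1, h2]

lemma pairing_succ (l a : ℕ) (m : ℤ) (d : ℤ → ℤ → ℝ) :
    pairing (l + a + 1) m (genCoeff l (a + 1)) d =
      pairing (l + a) m (genCoeff l a) (lower (l + a + 1) d) := by
  have key : pairing (l + a + 1) m (genCoeff l (a + 1)) d =
      (∑ i ∈ Finset.range (l + a + 2), ∑ j ∈ Finset.range (l + a + 2),
        if (i : ℤ) - j = m then
          (i ! * (l + a + 1 - i)! * (j ! * (l + a + 1 - j)!) : ℕ)
            * (genCoeff l a i j * d i j) else 0) +
      ∑ i ∈ Finset.range (l + a + 2), ∑ j ∈ Finset.range (l + a + 2),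
        if (i : ℤ) - j = m then
          (i ! * (l + a + 1 - i)! * (j ! * (l + a + 1 - j)!) : ℕ)
            * (genCoeff l a (i - 1) (j - 1) * d i j) else 0 := by
    simp only [pairing, ← Finset.sum_add_distrib, genCoeff_succ]
    refine Finset.sum_congr rfl fun i _ => Finset.sum_congr rfl fun j _ => ?_
    split_ifs <;> ring
  refine key.trans ((congrArg₂ (· + ·) (sum_sum_range_succ_of_last_eq_zero ?_ ?_)
    (sum_sum_range_succ_of_zero_eq_zero ?_ ?_)).trans ?_)
  iterate 4
    · intro i
      rw [genCoeff_eq_zero _ _ _ _ (by omega), zero_mul, mul_zero, ite_self]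
  simp only [pairing, ← Finset.sum_add_distrib]
  refine Finset.sum_congr rfl fun i hi => Finset.sum_congr rfl fun j hj => ?_
  rw [Finset.mem_range] at hi hj
  obtain ⟨p, hp⟩ : ∃ p, l + a = i + p := ⟨l + a - i, by omega⟩
  obtain ⟨q, hq⟩ : ∃ q, l + a = j + q := ⟨l + a - j, by omega⟩
  have hp' : (l : ℝ) + a = i + p := by exact_mod_cast hp
  have hq' : (l : ℝ) + a = j + q := by exact_mod_cast hq
  have e1 : l + a + 1 - i = p + 1 := by omega
  have e2 : l + a + 1 - j = q + 1 := by omega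
  have e3 : l + a + 1 - (i + 1) = p := by omega
  have e4 : l + a + 1 - (j + 1) = q := by omega
  have e5 : l + a - i = p := by omega
  have e6 : l + a - j = q := by omega
  have e7 : ((i + 1 : ℕ) : ℤ) - ((j + 1 : ℕ) : ℤ) = i - j := by push_cast; ring
  have c1 : (l : ℝ) + a + 1 - i = p + 1 := by linarith
  have c2 : (l : ℝ) + a + 1 - j = q + 1 := by linarith
  rw [e1, e2, e3, e4, e5, e6, e7]
  split_ifs
  · simp only [lower, Nat.factorial_succ]
    push_cast
    rw [c1, c2, add_sub_cancel_right, add_sub_cancel_right]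
    ring
  · simp

lemma pairing_smul_right (n : ℕ) (m : ℤ) (x : ℝ) (c d : ℤ → ℤ → ℝ) :
    pairing n m c (fun i j => x * d i j) = x * pairing n m c d := by
  simp only [pairing, Finset.mul_sum]
  refine Finset.sum_congr rfl fun i _ => Finset.sum_congr rfl fun j _ => ?_
  split_ifs <;> ring

lemma pairing_succ_succ (l a l' b : ℕ) (h : l + a = l' + b) (m : ℤ) :
    pairing (l + a + 1) m (genCoeff l (a + 1)) (genCoeff l' (b + 1)) =
      ((b + 1) * (b + 2 + 2 * l')) * pairing (l + a) m (genCoeff l a) (genCoeff l' b) := by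
  rw [pairing_succ, ← pairing_smul_right]
  congr 1
  funext i j
  rw [h, lower_genCoeff_succ]

lemma pairing_succ_zero (l a : ℕ) (m : ℤ) :
    pairing (l + a + 1) m (genCoeff l (a + 1)) (genCoeff (l + a + 1) 0) = 0 := by
  have h : lower (l + a + 1) (genCoeff (l + a + 1) 0) = fun _ _ => 0 := by
    funext i j
    exact lower_genCoeff_zero _ _ _
  rw [pairing_succ, h]
  simp [pairing]

lemma pairing_of_ne (l a l' b n : ℕ) (h : l + a = n) (h' : l' + b = n) (hne : l ≠ l') (m : ℤ) :
    pairing n m (genCoeff l a) (genCoeff l' b) = 0 := by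
  induction a generalizing b n with
  | zero =>
    obtain ⟨b, rfl⟩ : ∃ c, b = c + 1 := ⟨b - 1, by omega⟩
    obtain rfl : l = l' + b + 1 := by omega
    obtain rfl : n = l' + b + 1 := by omega
    rw [pairing_comm, pairing_succ_zero]
  | succ a ih =>
    subst h
    cases b with
    | zero =>
      obtain rfl : l' = l + a + 1 := by omega
      exact pairing_succ_zero _ _ _
    | succ b =>
      rw [← add_assoc, pairing_succ_succ l a l' b (by omega), ih b _ rfl (by omega), mul_zero]

lemma pairing_self_zero (l : ℕ) (m : ℤ) (hm : |m| ≤ l) :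
    pairing l m (genCoeff l 0) (genCoeff l 0) =
      (l ! : ℝ) ^ 2 * ((2 * l).choose (l + m).toNat) := by
  have hm' := abs_le.1 hm
  set M := (l + m).toNat with hM
  rw [two_mul, Nat.add_choose_eq]
  have h1 : ∀ i ∈ Finset.range (l + 1), (∑ j ∈ Finset.range (l + 1),
      if (i : ℤ) - j = m then ((i ! * (l - i)! * (j ! * (l - j)!) : ℕ) : ℝ) *
        (genCoeff l 0 i j * genCoeff l 0 i j) else 0) =
      ∑ j ∈ Finset.range (l + 1), if i + j = M then
        (l ! : ℝ) ^ 2 * (l.choose i * l.choose j : ℕ) else 0 := by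
    intro i hi
    rw [← Finset.sum_range_reflect]
    refine Finset.sum_congr rfl fun j hj => ?_
    rw [Finset.mem_range] at hi hj
    rw [show l + 1 - 1 - j = l - j by omega]
    refine if_congr (by omega) ?_ rfl
    rw [genCoeff_zero, chooseInt_natCast, chooseInt_natCast,
      show l - (l - j) = j by omega, Nat.choose_symm (by omega)]
    have f1 := Nat.choose_mul_factorial_mul_factorial (show i ≤ l by omega)
    have f2 := Nat.choose_mul_factorial_mul_factorial (show j ≤ l by omega)
    have s : ((-1 : ℝ) ^ (i : ℤ)) ^ 2 = 1 := by
      rw [zpow_natCast, ← pow_mul, mul_comm, pow_mul]; norm_num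
    have f1' : (l.choose i : ℝ) * i ! * (l - i)! = l ! := by exact_mod_cast f1
    have f2' : (l.choose j : ℝ) * j ! * (l - j)! = l ! := by exact_mod_cast f2
    push_cast
    calc _ = (((-1 : ℝ) ^ (i : ℤ)) ^ 2) * ((l.choose i : ℝ) * i ! * (l - i)!) *
          ((l.choose j : ℝ) * j ! * (l - j)!) * (l.choose i * l.choose j) := by ring
      _ = _ := by rw [s, f1', f2']; ring
  rw [pairing, Finset.sum_congr rfl h1, ← Finset.sum_product', ← Finset.sum_filter,
    Nat.cast_sum, Finset.mul_sum]
  refine Finset.sum_subset ?_ ?_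
  · intro x hx
    simpa using (Finset.mem_filter.1 hx).2
  · intro x hx hx'
    have hx1 : x.1 + x.2 = M := by simpa using hx
    have : l < x.1 ∨ l < x.2 := by
      by_contra! hcon
      exact hx' (by simp [hx1]; omega)
    rcases this with h | h <;> simp [Nat.choose_eq_zero_of_lt h]

lemma pairing_self (l a : ℕ) (m : ℤ) (hm : |m| ≤ l) :
    pairing (l + a) m (genCoeff l a) (genCoeff l a) * (2 * l + 1)! =
      a ! * (2 * l + 1 + a)! * ((l ! : ℝ) ^ 2 * ((2 * l).choose (l + m).toNat)) := by
  induction a with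
  | zero => rw [add_zero, pairing_self_zero l m hm]; simp; ring
  | succ a ih =>
    rw [← add_assoc, pairing_succ_succ l a l a rfl, mul_assoc, ih, ← add_assoc, Nat.factorial_succ,
      Nat.factorial_succ (2 * l + 1 + a)]
    push_cast
    ring

/-! ### The matrices `T^N_{ℓ,m}` are orthonormal -/

lemma invFactorial_natCast (k : ℕ) : invFactorial k = 1 / (k ! : ℝ) := by
  simp [invFactorial]

lemma invFactorial_mul_invFactorial (l : ℕ) (z : ℤ) :
    invFactorial z * invFactorial (l - z) = chooseInt l z / l ! := by
  rcases lt_or_ge z 0 with hz | hz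
  · simp [chooseInt_of_neg l hz, invFactorial, hz]
  rcases lt_or_ge (l : ℤ) z with h | h
  · simp [chooseInt_of_lt l h, invFactorial, h]
  · lift z to ℕ using hz
    have h' : z ≤ l := by exact_mod_cast h
    rw [show (l : ℤ) - z = ((l - z : ℕ) : ℤ) by omega, invFactorial_natCast, invFactorial_natCast,
      chooseInt_natCast, Nat.cast_choose ℝ h']
    have := Nat.factorial_ne_zero l
    have := Nat.factorial_ne_zero z
    have := Nat.factorial_ne_zero (l - z)
    field_simp

lemma wigner3j_eq (n l i j : ℕ) (m : ℤ) (hl : l ≤ n) (hi : i ≤ n) (hj : j ≤ n) (hm : |m| ≤ l) :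
    wigner3j n (2 * l) n (-(2 * (i : ℤ) - n)) (2 * m) (2 * (j : ℤ) - n) =
      if (i : ℤ) - j = m then
        (-1 : ℝ) ^ ((n : ℤ) - l - j)
          * √(((l ! * (n - l)! * l ! : ℕ) : ℝ) / ((n + l + 1)! : ℝ))
          * √(((n - i)! * i ! * (l + m).toNat ! * (l - m).toNat ! * j ! * (n - j)! : ℕ) : ℝ)
          * (genCoeff l (n - l) i j / (l ! * l ! * (n - l)!)) else 0 := by
  have hm' := abs_le.1 hm
  split_ifs with h
  · rw [wigner3j, if_pos]
    · have e1 : ((n : ℤ) - 2 * l - (2 * j - n)) / 2 = n - l - j := by omega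
      have e2 : (((n : ℤ) + 2 * l - n) / 2) = l := by omega
      have e3 : (((n : ℤ) - 2 * l + n) / 2) = ((n - l : ℕ) : ℤ) := by omega
      have e4 : ((-(n : ℤ) + 2 * l + n) / 2) = l := by omega
      have e5 : (((n : ℤ) + 2 * l + n) / 2 + 1) = ((n + l + 1 : ℕ) : ℤ) := by omega
      have e6 : (((n : ℤ) + -(2 * i - n)) / 2) = ((n - i : ℕ) : ℤ) := by omega
      have e7 : (((n : ℤ) - -(2 * i - n)) / 2) = i := by omega
      have e8 : ((2 * (l : ℤ) + 2 * m) / 2) = l + m := by omega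
      have e9 : ((2 * (l : ℤ) - 2 * m) / 2) = l - m := by omega
      have e10 : ((n : ℤ) + (2 * j - n)) / 2 = j := by omega
      have e11 : ((n : ℤ) - (2 * j - n)) / 2 = ((n - j : ℕ) : ℤ) := by omega
      have e12 : ((n : ℤ) - 2 * l + -(2 * i - n)) / 2 = n - l - i := by omega
      have e13 : ((n : ℤ) - n - 2 * m) / 2 = -m := by omega
      simp only [e1, e2, e3, e4, e5, e6, e7, e8, e9, e10, e11, e12, e13, Int.toNat_natCast]
      congr 1
      rw [genCoeff, Finset.sum_div]
      refine Finset.sum_congr rfl fun k hk => ?_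
      have hk' : k ≤ l := by simpa [Nat.lt_succ_iff] using hk
      have f1 := invFactorial_mul_invFactorial l k
      have f2 := invFactorial_mul_invFactorial l (j - i + k)
      have f3 := invFactorial_mul_invFactorial (n - l) (i - k)
      rw [chooseInt_natCast] at f1
      rw [show (l : ℤ) - (j - i + k) = l + m - k by omega,
        show (j : ℤ) - i + k = -m + k by omega] at f2
      rw [show ((n - l : ℕ) : ℤ) - (i - k) = n - l - i + k by omega] at f3
      rw [show (j : ℤ) - i + k = -m + k by omega]
      calc _ = (-1 : ℝ) ^ k * (invFactorial k * invFactorial (l - k)) *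
            (invFactorial (-m + k) * invFactorial (l + m - k)) *
            (invFactorial (i - k) * invFactorial (n - l - i + k)) := by ring
        _ = _ := by
          rw [f1, f2, f3]
          ring
    · refine ⟨⟨n + l, by ring⟩, ⟨n - i, by ring⟩, ⟨l + m, by ring⟩, ⟨j, by ring⟩, by omega,
        abs_le.2 ⟨by omega, by omega⟩, abs_le.2 ⟨by omega, by omega⟩, abs_le.2 ⟨by omega, by omega⟩,
        abs_le.2 ⟨by omega, by omega⟩, by omega⟩
  · rw [wigner3j, if_neg]
    intro hc
    have := hc.2.2.2.2.1
    omega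

/-- The normalization of the entries of `T^{n+1}_{l,m}`. -/
def normConst (n l : ℕ) (m : ℤ) : ℝ :=
  (-1 : ℝ) ^ (m - l) * √(((n + 1 : ℕ) : ℝ) / (4 * Real.pi)) * √(2 * (l : ℝ) + 1)
    * √(((l ! * (n - l)! * l ! : ℕ) : ℝ) / ((n + l + 1)! : ℝ))
    * √(((l + m).toNat ! * (l - m).toNat ! : ℕ) : ℝ) / (l ! * l ! * (n - l)!)

lemma T_apply (n l : ℕ) (m : ℤ) (hl : l ≤ n) (hm : |m| ≤ l) (i j : Fin (n + 1)) :
    T (n + 1) l m i j = ((if ((i : ℕ) : ℤ) - (j : ℕ) = m then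
      normConst n l m * √(((i : ℕ)! * (n - i)! * ((j : ℕ)! * (n - j)!) : ℕ) : ℝ) *
        genCoeff l (n - l) (i : ℕ) (j : ℕ) else 0 : ℝ) : ℂ) := by
  have hi := i.is_le
  have hj := j.is_le
  rw [T]
  congr 1
  rw [show ((n + 1 : ℕ) : ℤ) - 1 = n by push_cast; ring, wigner3j_eq n l i j m hl hi hj hm]
  split_ifs with h
  · rw [show n + 1 - 1 - (i : ℕ) = n - i by omega]
    have s : (-1 : ℝ) ^ (n - (i : ℕ)) * (-1 : ℝ) ^ ((n : ℤ) - l - (j : ℕ)) = (-1 : ℝ) ^ (m - l) := by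
      rw [← zpow_natCast, ← zpow_add₀ (by norm_num),
        show ((n - (i : ℕ) : ℕ) : ℤ) + (n - l - (j : ℕ)) = (m - l) + 2 * (n - (i : ℕ)) by omega,
        zpow_add₀ (by norm_num), zpow_mul]
      norm_num
    have q : √(((n - (i : ℕ))! * (i : ℕ)! * (l + m).toNat ! * (l - m).toNat ! * (j : ℕ)! *
        (n - (j : ℕ))! : ℕ) : ℝ) = √(((l + m).toNat ! * (l - m).toNat ! : ℕ) : ℝ) *
        √(((i : ℕ)! * (n - i)! * ((j : ℕ)! * (n - j)!) : ℕ) : ℝ) := by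
      rw [← Real.sqrt_mul (by positivity)]
      congr 1
      push_cast
      ring
    rw [q, normConst, ← s]
    ring
  · simp

lemma innerN_T (n l l' : ℕ) (m m' : ℤ) (hl : l ≤ n) (hl' : l' ≤ n) (hm : |m| ≤ l)
    (hm' : |m'| ≤ l') :
    innerN (T (n + 1) l m) (T (n + 1) l' m') =
      ((4 * Real.pi / ((n + 1 : ℕ) : ℝ) * (if m = m' then normConst n l m * normConst n l' m' *
        pairing n m (genCoeff l (n - l)) (genCoeff l' (n - l')) else 0) : ℝ) : ℂ) := by
  rw [innerN, Complex.ofReal_mul]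
  congr 1
  rw [Matrix.trace, pairing]
  simp only [Matrix.diag_apply, Matrix.mul_apply, Matrix.conjTranspose_apply,
    T_apply n l m hl hm, T_apply n l' m' hl' hm']
  rw [Finset.sum_comm]
  simp only [Finset.sum_range, RCLike.star_def, Complex.conj_ofReal, ← Complex.ofReal_mul,
    ← Complex.ofReal_sum]
  congr 1
  split_ifs with h
  · subst h
    rw [Finset.mul_sum]
    refine Finset.sum_congr rfl fun i _ => ?_
    rw [Finset.mul_sum]
    refine Finset.sum_congr rfl fun j _ => ?_
    split_ifs with h
    · have := Real.mul_self_sqrt (show (0 : ℝ) ≤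
        (((i : ℕ)! * (n - i)! * ((j : ℕ)! * (n - j)!) : ℕ) : ℝ) by positivity)
      linear_combination normConst n l m * normConst n l' m * genCoeff l (n - l) (i : ℕ) (j : ℕ) *
        genCoeff l' (n - l') (i : ℕ) (j : ℕ) * this
    · simp
  · refine Finset.sum_eq_zero fun i _ => Finset.sum_eq_zero fun j _ => ?_
    split_ifs with h1 h2
    · omega
    all_goals simp

lemma normConst_sq_mul_pairing (n l : ℕ) (m : ℤ) (hl : l ≤ n) (hm : |m| ≤ l) :
    4 * Real.pi / ((n + 1 : ℕ) : ℝ) * (normConst n l m * normConst n l m *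
      pairing n m (genCoeff l (n - l)) (genCoeff l (n - l))) = 1 := by
  have hm' := abs_le.1 hm
  have hp := pairing_self l (n - l) m hm
  rw [show l + (n - l) = n by omega, show 2 * l + 1 + (n - l) = n + l + 1 by omega] at hp
  set G := pairing n m (genCoeff l (n - l)) (genCoeff l (n - l))
  have hc := Nat.choose_mul_factorial_mul_factorial (show (l + m).toNat ≤ 2 * l by omega)
  rw [show 2 * l - (l + m).toNat = (l - m).toNat by omega] at hc
  have hc' : ((2 * l).choose (l + m).toNat : ℝ) * (l + m).toNat ! * (l - m).toNat ! = (2 * l)! := by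
    exact_mod_cast hc
  have hsq : normConst n l m * normConst n l m =
      ((n + 1 : ℕ) : ℝ) / (4 * Real.pi) * (2 * (l : ℝ) + 1)
        * (((l ! * (n - l)! * l ! : ℕ) : ℝ) / ((n + l + 1)! : ℝ))
        * (((l + m).toNat ! * (l - m).toNat ! : ℕ) : ℝ) / (l ! * l ! * (n - l)!) ^ 2 := by
    have s : (-1 : ℝ) ^ (m - l) * (-1 : ℝ) ^ (m - l) = 1 := by
      rw [← mul_zpow]; norm_num
    have s1 := Real.mul_self_sqrt (show (0 : ℝ) ≤ ((n + 1 : ℕ) : ℝ) / (4 * Real.pi) by positivity)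
    have s2 := Real.mul_self_sqrt (show (0 : ℝ) ≤ 2 * (l : ℝ) + 1 by positivity)
    have s3 := Real.mul_self_sqrt (show (0 : ℝ) ≤
      ((l ! * (n - l)! * l ! : ℕ) : ℝ) / ((n + l + 1)! : ℝ) by positivity)
    have s4 := Real.mul_self_sqrt (show (0 : ℝ) ≤
      (((l + m).toNat ! * (l - m).toNat ! : ℕ) : ℝ) by positivity)
    rw [← s1, ← s2, ← s3, ← s4]
    calc _ = ((-1 : ℝ) ^ (m - l) * (-1 : ℝ) ^ (m - l)) *
        ((√(((n + 1 : ℕ) : ℝ) / (4 * Real.pi)) * √(((n + 1 : ℕ) : ℝ) / (4 * Real.pi))) *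
        (√(2 * (l : ℝ) + 1) * √(2 * (l : ℝ) + 1)) *
        (√(((l ! * (n - l)! * l ! : ℕ) : ℝ) / ((n + l + 1)! : ℝ)) *
          √(((l ! * (n - l)! * l ! : ℕ) : ℝ) / ((n + l + 1)! : ℝ))) *
        (√(((l + m).toNat ! * (l - m).toNat ! : ℕ) : ℝ) *
          √(((l + m).toNat ! * (l - m).toNat ! : ℕ) : ℝ)) /
          (l ! * l ! * (n - l)!) ^ 2) := by rw [normConst]; ring
      _ = _ := by rw [s, one_mul]
  rw [Nat.factorial_succ] at hp
  rw [hsq]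
  have hne : ((2 * l)! : ℝ) ≠ 0 := by positivity
  have hG : G = (n - l)! * (n + l + 1)! * ((l ! : ℝ) ^ 2 * ((2 * l).choose (l + m).toNat)) /
      ((2 * l + 1) * (2 * l)!) := by
    rw [eq_div_iff (by positivity), ← hp]
    push_cast
    ring
  rw [hG, ← hc']
  have hch : ((2 * l).choose (l + m).toNat : ℝ) ≠ 0 := by
    intro h0
    rw [h0] at hc'
    simp only [zero_mul] at hc'
    exact hne hc'.symm
  have := Real.pi_pos
  push_cast
  field_simp

lemma innerN_T_eq_ite (N l l' : ℕ) (m m' : ℤ) (hl : l < N) (hl' : l' < N) (hm : |m| ≤ l)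
    (hm' : |m'| ≤ l') :
    innerN (T N l m) (T N l' m') = if l = l' ∧ m = m' then 1 else 0 := by
  obtain ⟨n, rfl⟩ : ∃ n, N = n + 1 := ⟨N - 1, by omega⟩
  rw [innerN_T n l l' m m' (by omega) (by omega) hm hm']
  split_ifs with h1 h2 h2
  · obtain ⟨rfl, -⟩ := h2
    subst h1
    rw [normConst_sq_mul_pairing n l m (by omega) hm, Complex.ofReal_one]
  · rw [pairing_of_ne l (n - l) l' (n - l') n (by omega) (by omega) (fun h => h2 ⟨h, h1⟩)]
    simp
  · exact absurd h2.2 h1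
  · simp

lemma T_zero_zero (N : ℕ) : ∃ c : ℂ, T N 0 0 = c • (1 : Matrix (Fin N) (Fin N) ℂ) := by
  rcases N with _ | n
  · exact ⟨0, Subsingleton.elim _ _⟩
  refine ⟨(normConst n 0 0 * n ! : ℝ), ?_⟩
  ext i j
  rw [T_apply n 0 0 (by omega) (by simp), Matrix.smul_apply, Matrix.one_apply]
  by_cases h : i = j
  · subst h
    have hi := i.is_le
    rw [if_pos (by simp), if_pos rfl, smul_eq_mul, mul_one, Nat.cast_mul,
      Real.sqrt_mul_self (by positivity), mul_assoc]
    congr 2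
    simp only [genCoeff, zero_add, Finset.range_one, Finset.sum_singleton, sub_self, Nat.sub_zero,
      Nat.cast_zero, sub_zero, chooseInt_natCast]
    rw [← Nat.choose_mul_factorial_mul_factorial hi]
    push_cast
    simp
    ring
  · rw [if_neg (by omega), if_neg h]
    simp

/-! ### The quantized Laplacian and its inverse -/

/-- The entries of a matrix as a vector of the Euclidean space with the same norm. -/
def vec {N : ℕ} : Matrix (Fin N) (Fin N) ℂ →ₗ[ℂ] EuclideanSpace ℂ (Fin N × Fin N) where
  toFun A := WithLp.toLp 2 fun p => A p.1 p.2
  map_add' _ _ := rfl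
  map_smul' _ _ := rfl

lemma vec_apply {N : ℕ} (A : Matrix (Fin N) (Fin N) ℂ) (p : Fin N × Fin N) :
    vec A p = A p.1 p.2 := rfl

lemma vec_injective {N : ℕ} : Function.Injective (vec (N := N)) := fun A B h => by
  ext i j
  rw [← vec_apply A (i, j), h, vec_apply]

lemma norm_vec {N : ℕ} (A : Matrix (Fin N) (Fin N) ℂ) : ‖vec A‖ = ‖A‖ := by
  rw [EuclideanSpace.norm_eq, Matrix.frobenius_norm_def, Real.sqrt_eq_rpow, Fintype.sum_prod_type]
  simp [vec_apply]

lemma inner_vec {N : ℕ} (A B : Matrix (Fin N) (Fin N) ℂ) :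
    inner ℂ (vec A) (vec B) = (Aᴴ * B).trace := by
  rw [PiLp.inner_apply, Fintype.sum_prod_type, Finset.sum_comm]
  simp only [vec_apply, Matrix.trace, Matrix.diag_apply, Matrix.mul_apply,
    Matrix.conjTranspose_apply, RCLike.inner_apply, RCLike.star_def]
  exact Finset.sum_congr rfl fun i _ => Finset.sum_congr rfl fun j _ => mul_comm _ _

/-- The index set `{(ℓ, m) : 0 ≤ ℓ ≤ N - 1, -ℓ ≤ m ≤ ℓ}`. -/
def indexSet (N : ℕ) : Finset ((_ : ℕ) × ℤ) :=
  (Finset.range N).sigma fun ℓ => Finset.Icc (-(ℓ : ℤ)) (ℓ : ℤ)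

lemma mem_indexSet {N : ℕ} {x : (_ : ℕ) × ℤ} : x ∈ indexSet N ↔ x.1 < N ∧ |x.2| ≤ x.1 := by
  simp [indexSet, abs_le]

lemma card_indexSet (N : ℕ) : (indexSet N).card = N * N := by
  rw [indexSet, Finset.card_sigma]
  induction N with
  | zero => simp
  | succ n ih =>
    rw [Finset.sum_range_succ, ih, Int.card_Icc,
      show ((n : ℤ) + 1 - -n).toNat = 2 * n + 1 by omega]
    ring

lemma innerN_eq_inner {N : ℕ} (A B : Matrix (Fin N) (Fin N) ℂ) :
    innerN A B = inner ℂ (vec ((√(4 * Real.pi / N) : ℂ) • A)) (vec ((√(4 * Real.pi / N) : ℂ) • B)) := by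
  rw [map_smul, map_smul, inner_smul_left, inner_smul_right, Complex.conj_ofReal, inner_vec,
    innerN, ← mul_assoc, ← Complex.ofReal_mul, Real.mul_self_sqrt (by positivity)]

lemma orthonormal_T (N : ℕ) : Orthonormal ℂ fun x : indexSet N =>
    vec ((√(4 * Real.pi / N) : ℂ) • T N x.1.1 x.1.2) := by
  rw [orthonormal_iff_ite]
  rintro ⟨x, hx⟩ ⟨y, hy⟩
  rw [mem_indexSet] at hx hy
  rw [← innerN_eq_inner, innerN_T_eq_ite N _ _ _ _ hx.1 hy.1 hx.2 hy.2]
  refine if_congr ?_ rfl rfl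
  rw [Subtype.mk.injEq, Sigma.ext_iff, heq_eq_eq]

/-- The matrices `√(4π/N) T^N_{ℓ,m}` as an orthonormal basis. -/
def basisT (N : ℕ) : OrthonormalBasis (indexSet N) ℂ (EuclideanSpace ℂ (Fin N × Fin N)) :=
  OrthonormalBasis.mk (orthonormal_T N)
    ((orthonormal_T N).linearIndependent.span_eq_top_of_card_eq_finrank'
      (by simp [card_indexSet])).ge

lemma basisT_apply {N : ℕ} (x : indexSet N) :
    basisT N x = vec ((√(4 * Real.pi / N) : ℂ) • T N x.1.1 x.1.2) := by
  rw [basisT, OrthonormalBasis.coe_mk]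

lemma vec_spectralOp (N : ℕ) (f : ℕ → ℝ) (A : Matrix (Fin N) (Fin N) ℂ) :
    vec (spectralOp N f A) =
      ∑ x : indexSet N, ((f x.1.1 : ℂ) * inner ℂ (basisT N x) (vec A)) • basisT N x := by
  rw [spectralOp, Finset.sum_sigma', ← indexSet, ← Finset.sum_coe_sort (indexSet N), map_sum]
  refine Finset.sum_congr rfl fun x _ => ?_
  rw [basisT_apply, innerN, map_smul, map_smul, inner_smul_left, inner_vec, smul_smul,
    Complex.conj_ofReal]
  congr 1
  have h : ((4 * Real.pi / N : ℝ) : ℂ) = √(4 * Real.pi / N) * √(4 * Real.pi / N) := by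
    rw [← Complex.ofReal_mul, Real.mul_self_sqrt (by positivity)]
  rw [h]
  ring

lemma inner_basisT_spectralOp (N : ℕ) (f : ℕ → ℝ) (A : Matrix (Fin N) (Fin N) ℂ) (x : indexSet N) :
    inner ℂ (basisT N x) (vec (spectralOp N f A)) = f x.1.1 * inner ℂ (basisT N x) (vec A) := by
  rw [vec_spectralOp, (basisT N).orthonormal.inner_right_fintype]

lemma norm_spectralOp_le {N : ℕ} {f : ℕ → ℝ} {C : ℝ} (hC : 0 ≤ C) (hf : ∀ ℓ, |f ℓ| ≤ C)
    (A : Matrix (Fin N) (Fin N) ℂ) : ‖spectralOp N f A‖ ≤ C * ‖A‖ := by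
  rw [← norm_vec, ← norm_vec A]
  refine le_of_sq_le_sq ?_ (by positivity)
  rw [mul_pow, ← (basisT N).sum_sq_norm_inner_right, ← (basisT N).sum_sq_norm_inner_right (vec A),
    Finset.mul_sum]
  refine Finset.sum_le_sum fun x _ => ?_
  rw [inner_basisT_spectralOp, norm_mul, mul_pow, Complex.norm_real, Real.norm_eq_abs]
  gcongr
  exact hf _

lemma norm_invLaplacian_le {N : ℕ} (A : Matrix (Fin N) (Fin N) ℂ) :
    ‖invLaplacian N A‖ ≤ 1 / 2 * ‖A‖ := by
  refine norm_spectralOp_le (by norm_num) (fun ℓ => ?_) A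
  split_ifs with h
  · norm_num
  · have h1 : (1 : ℝ) ≤ ℓ := by exact_mod_cast Nat.one_le_iff_ne_zero.2 h
    rw [abs_neg, abs_inv, one_div]
    refine inv_anti₀ (by norm_num) ?_
    rw [abs_of_nonneg (by positivity)]
    nlinarith

lemma spectralOp_sub {N : ℕ} (f : ℕ → ℝ) (A B : Matrix (Fin N) (Fin N) ℂ) :
    spectralOp N f (A - B) = spectralOp N f A - spectralOp N f B := by
  apply vec_injective
  rw [map_sub, vec_spectralOp, vec_spectralOp, vec_spectralOp, ← Finset.sum_sub_distrib]
  refine Finset.sum_congr rfl fun x _ => ?_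
  rw [map_sub, inner_sub_right, mul_sub, sub_smul]

lemma inner_basisT_one {N : ℕ} (x : indexSet N) (hx : x.1.1 ≠ 0) :
    inner ℂ (basisT N x) (vec (1 : Matrix (Fin N) (Fin N) ℂ)) = 0 := by
  have hx' := mem_indexSet.1 x.2
  have hN : 0 < N := by omega
  obtain ⟨c, hc⟩ := T_zero_zero N
  have hc0 : c ≠ 0 := by
    rintro rfl
    have := innerN_T_eq_ite N 0 0 0 0 hN hN (by simp) (by simp)
    rw [hc] at this
    simp [innerN] at this
  have h := innerN_T_eq_ite N x.1.1 0 x.1.2 0 hx'.1 hN hx'.2 (by simp)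
  rw [if_neg (fun h => hx h.1), innerN_eq_inner, ← basisT_apply, map_smul, hc, map_smul,
    inner_smul_right, inner_smul_right] at h
  have h4 : ((√(4 * Real.pi / N) : ℝ) : ℂ) ≠ 0 := by
    have : (0 : ℝ) < N := by exact_mod_cast hN
    have := Real.pi_pos
    exact Complex.ofReal_ne_zero.2 (Real.sqrt_ne_zero'.2 (by positivity))
  exact (mul_eq_zero.1 ((mul_eq_zero.1 h).resolve_left h4)).resolve_left hc0

/-- A stream matrix `P` of `W` agrees with `Δ_N⁻¹ W` up to a multiple of the identity matrix. -/
lemma exists_eq_invLaplacian_add {N : ℕ} {P W : Matrix (Fin N) (Fin N) ℂ} {c : ℂ}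
    (h : laplacian N P = W - c • (1 : Matrix (Fin N) (Fin N) ℂ)) :
    ∃ d : ℂ, P = invLaplacian N W + d • (1 : Matrix (Fin N) (Fin N) ℂ) := by
  have key : ∀ x : indexSet N, x.1.1 ≠ 0 →
      inner ℂ (basisT N x) (vec (P - invLaplacian N W)) = 0 := by
    intro x hx
    have h1 := inner_basisT_spectralOp N (fun ℓ => -((ℓ : ℝ) * (ℓ + 1))) P x
    have h2 := inner_basisT_spectralOp N (fun ℓ => if ℓ = 0 then 0 else -((ℓ : ℝ) * (ℓ + 1))⁻¹) W x
    rw [← laplacian, h, map_sub, map_smul, inner_sub_right, inner_smul_right,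
      inner_basisT_one x hx, mul_zero, sub_zero] at h1
    rw [← invLaplacian, h1, if_neg hx] at h2
    rw [map_sub, inner_sub_right, h2]
    have h3 : (x.1.1 : ℂ) ≠ 0 := Nat.cast_ne_zero.2 hx
    have h4 : (x.1.1 : ℂ) + 1 ≠ 0 := Nat.cast_add_one_ne_zero _
    push_cast
    field_simp
    ring
  obtain ⟨c0, hc0⟩ := T_zero_zero N
  rcases Nat.eq_zero_or_pos N with rfl | hN
  · exact ⟨0, Subsingleton.elim _ _⟩
  let x0 : indexSet N := ⟨⟨0, 0⟩, mem_indexSet.2 ⟨hN, by simp⟩⟩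
  have hD := (basisT N).sum_repr' (vec (P - invLaplacian N W))
  rw [Finset.sum_eq_single x0] at hD
  · rw [basisT_apply x0, ← map_smul] at hD
    have hD' := vec_injective hD
    rw [show T N x0.1.1 x0.1.2 = T N 0 0 from rfl, hc0, smul_smul, smul_smul] at hD'
    exact ⟨_, by rw [hD']; abel⟩
  · intro x _ hx
    rw [key x, zero_smul]
    intro hx1
    apply hx
    have hx2 := (mem_indexSet.1 x.2).2
    rw [hx1, Nat.cast_zero, abs_nonpos_iff] at hx2
    exact Subtype.ext (Sigma.ext hx1 (heq_of_eq hx2))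
  · intro hx
    exact absurd (Finset.mem_univ x0) hx

open scoped ComplexOrder

/-! ### Best rank-`r` approximations of skew-Hermitian matrices -/

variable {N : ℕ}

lemma norm_sq_eq_trace (A : Matrix (Fin N) (Fin N) ℂ) : ((‖A‖ ^ 2 : ℝ) : ℂ) = (Aᴴ * A).trace := by
  rw [← norm_vec, ← inner_vec, inner_self_eq_norm_sq_to_K]
  norm_cast

lemma norm_add_sq_of_trace_eq_zero {A B : Matrix (Fin N) (Fin N) ℂ} (h : (Aᴴ * B).trace = 0) :
    ‖A + B‖ ^ 2 = ‖A‖ ^ 2 + ‖B‖ ^ 2 := by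
  rw [← norm_vec, ← norm_vec A, ← norm_vec B, map_add, norm_add_sq (𝕜 := ℂ), inner_vec, h]
  simp

lemma norm_eq_of_trace_eq {A B : Matrix (Fin N) (Fin N) ℂ}
    (h : (Aᴴ * A).trace = (Bᴴ * B).trace) : ‖A‖ = ‖B‖ := by
  rw [← norm_sq_eq_trace, ← norm_sq_eq_trace, Complex.ofReal_inj] at h
  exact (pow_left_inj₀ (norm_nonneg _) (norm_nonneg _) two_ne_zero).1 h

lemma conjTranspose_mul_self_of_mem {U : Matrix (Fin N) (Fin N) ℂ}
    (hU : U ∈ Matrix.unitaryGroup (Fin N) ℂ) : Uᴴ * U = 1 :=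
  Matrix.mem_unitaryGroup_iff'.1 hU

lemma mul_conjTranspose_self_of_mem {U : Matrix (Fin N) (Fin N) ℂ}
    (hU : U ∈ Matrix.unitaryGroup (Fin N) ℂ) : U * Uᴴ = 1 :=
  Matrix.mem_unitaryGroup_iff.1 hU

lemma norm_unitary_conj {U : Matrix (Fin N) (Fin N) ℂ} (hU : U ∈ Matrix.unitaryGroup (Fin N) ℂ)
    (A : Matrix (Fin N) (Fin N) ℂ) : ‖U * A * Uᴴ‖ = ‖A‖ := by
  apply norm_eq_of_trace_eq
  have h := conjTranspose_mul_self_of_mem hU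
  calc _ = (U * (Aᴴ * (Uᴴ * U) * A * Uᴴ)).trace := by
        simp only [Matrix.conjTranspose_mul, Matrix.conjTranspose_conjTranspose, Matrix.mul_assoc]
    _ = (Aᴴ * A * (Uᴴ * U)).trace := by
        rw [Matrix.trace_mul_comm, h]
        simp only [Matrix.mul_assoc, Matrix.mul_one, h]
    _ = _ := by rw [h, Matrix.mul_one]

lemma aeval_unitary_conj {U : Matrix (Fin N) (Fin N) ℂ} (hU : U ∈ Matrix.unitaryGroup (Fin N) ℂ)
    (A : Matrix (Fin N) (Fin N) ℂ) (p : Polynomial ℂ) :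
    Polynomial.aeval (U * A * Uᴴ) p = U * Polynomial.aeval A p * Uᴴ := by
  induction p using Polynomial.induction_on' with
  | add p q hp hq => rw [map_add, map_add, hp, hq, Matrix.mul_add, Matrix.add_mul]
  | monomial n a =>
    rw [Polynomial.aeval_monomial, Polynomial.aeval_monomial, Algebra.algebraMap_eq_smul_one,
      smul_one_mul, smul_one_mul, Matrix.mul_smul, Matrix.smul_mul]
    congr 1
    induction n with
    | zero => simp [mul_conjTranspose_self_of_mem hU]
    | succ n ih =>
      rw [pow_succ, ih, pow_succ]
      simp only [Matrix.mul_assoc]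
      rw [← Matrix.mul_assoc Uᴴ U, conjTranspose_mul_self_of_mem hU, Matrix.one_mul]

lemma aeval_diagonal (d : Fin N → ℂ) (p : Polynomial ℂ) :
    Polynomial.aeval (Matrix.diagonal d) p = Matrix.diagonal fun i => p.eval (d i) := by
  induction p using Polynomial.induction_on' with
  | add p q hp hq => rw [map_add, hp, hq, Matrix.diagonal_add]; simp
  | monomial n a =>
    rw [Polynomial.aeval_monomial, Algebra.algebraMap_eq_smul_one, smul_one_mul,
      Matrix.diagonal_pow, ← Matrix.diagonal_smul]
    congr 1
    ext i
    simp

lemma exists_polynomial_eval_eq (S : Finset ℂ) (g : ℂ → ℂ) :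
    ∃ p : Polynomial ℂ, ∀ z ∈ S, p.eval z = g z :=
  ⟨Lagrange.interpolate S id g, fun _ hz =>
    Lagrange.eval_interpolate_at_node g (Set.injOn_id _) hz⟩

lemma exists_unitary_diagonal_of_isHermitian {A : Matrix (Fin N) (Fin N) ℂ} (hA : A.IsHermitian) :
    ∃ U ∈ Matrix.unitaryGroup (Fin N) ℂ,
      A = U * Matrix.diagonal (fun i => (hA.eigenvalues i : ℂ)) * Uᴴ :=
  ⟨hA.eigenvectorUnitary, hA.eigenvectorUnitary.2, hA.spectral_theorem⟩

lemma exists_unitary_diagonal_sigma (A : Matrix (Fin N) (Fin N) ℂ) :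
    ∃ U ∈ Matrix.unitaryGroup (Fin N) ℂ, Aᴴ * A =
      U * Matrix.diagonal (fun i : Fin N => ((sigma A (i + 1) ^ 2 : ℝ) : ℂ)) * Uᴴ := by
  set S := Matrix.toEuclideanLin A
  have hfin : Module.finrank ℂ (EuclideanSpace ℂ (Fin N)) = N := by simp
  set b := S.isSymmetric_adjoint_comp_self.eigenvectorBasis hfin with hb
  let U : Matrix (Fin N) (Fin N) ℂ := Matrix.of fun k i => b i k
  have h1 : Uᴴ * U = 1 := by
    ext i j
    rw [Matrix.mul_apply, Matrix.one_apply, ← orthonormal_iff_ite.1 b.orthonormal i j,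
      PiLp.inner_apply]
    simp only [U, Matrix.conjTranspose_apply, Matrix.of_apply, RCLike.inner_apply, RCLike.star_def]
    exact Finset.sum_congr rfl fun k _ => mul_comm _ _
  have h2 : Aᴴ * A * U = U * Matrix.diagonal (fun i : Fin N => ((sigma A (i + 1) ^ 2 : ℝ) : ℂ)) := by
    ext k i
    have h := S.isSymmetric_adjoint_comp_self.apply_eigenvectorBasis hfin i
    rw [← S.sq_singularValues_fin hfin i, ← hb, LinearMap.comp_apply,
      ← Matrix.toEuclideanLin_conjTranspose_eq_adjoint] at h
    have h' := congrFun (congrArg WithLp.ofLp h) k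
    rw [Matrix.mul_diagonal, Matrix.mul_assoc]
    simp only [S, Matrix.toLpLin_apply, Matrix.mulVec_mulVec, PiLp.smul_apply, smul_eq_mul] at h'
    rw [← Matrix.mul_assoc, Matrix.mul_apply]
    simp only [Matrix.mulVec, dotProduct] at h'
    simp only [U, Matrix.of_apply, sigma, Nat.add_sub_cancel]
    rw [mul_comm (b i k)]
    exact h'
  have h3 : U * Uᴴ = 1 := mul_eq_one_comm.1 h1
  refine ⟨U, Matrix.mem_unitaryGroup_iff.2 h3, ?_⟩
  rw [← h2, Matrix.mul_assoc, h3, Matrix.mul_one]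

lemma conj_diagonal_indicator {U : Matrix (Fin N) (Fin N) ℂ}
    (hU : U ∈ Matrix.unitaryGroup (Fin N) ℂ) (s : Fin N → Prop) [DecidablePred s] :
    (U * Matrix.diagonal (fun i => if s i then (1 : ℂ) else 0) * Uᴴ)ᴴ =
        U * Matrix.diagonal (fun i => if s i then (1 : ℂ) else 0) * Uᴴ ∧
      U * Matrix.diagonal (fun i => if s i then (1 : ℂ) else 0) * Uᴴ *
        (U * Matrix.diagonal (fun i => if s i then (1 : ℂ) else 0) * Uᴴ) =
        U * Matrix.diagonal (fun i => if s i then (1 : ℂ) else 0) * Uᴴ := by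
  have h1 := conjTranspose_mul_self_of_mem hU
  set D : Matrix (Fin N) (Fin N) ℂ := Matrix.diagonal fun i => if s i then 1 else 0 with hD
  have hDD : D * D = D := by
    rw [hD, Matrix.diagonal_mul_diagonal]
    congr 1
    ext i
    split_ifs <;> simp
  have hDs : Dᴴ = D := by
    rw [hD, Matrix.diagonal_conjTranspose]
    congr 1
    ext i
    simp only [Pi.star_apply]
    split_ifs <;> simp
  constructor
  · simp only [Matrix.conjTranspose_mul, Matrix.conjTranspose_conjTranspose, hDs, Matrix.mul_assoc]
  · calc _ = U * (D * (Uᴴ * U) * D) * Uᴴ := by simp only [Matrix.mul_assoc]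
      _ = _ := by rw [h1, Matrix.mul_one, hDD]

lemma exists_projection (B : Matrix (Fin N) (Fin N) ℂ) :
    ∃ Q : Matrix (Fin N) (Fin N) ℂ, Qᴴ = Q ∧ Q * Q = Q ∧ Q * B = B ∧ Q.trace = B.rank := by
  have hH : (B * Bᴴ).IsHermitian := Matrix.isHermitian_mul_conjTranspose_self B
  obtain ⟨V, hV, hB⟩ := exists_unitary_diagonal_of_isHermitian hH
  set d := hH.eigenvalues with hd
  have h1 := conjTranspose_mul_self_of_mem hV
  obtain ⟨hQ, hQQ⟩ := conj_diagonal_indicator hV (fun i => d i ≠ 0)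
  set D : Matrix (Fin N) (Fin N) ℂ := Matrix.diagonal fun i => if d i ≠ 0 then 1 else 0 with hD
  refine ⟨V * D * Vᴴ, hQ, hQQ, ?_, ?_⟩
  · have hQM : V * D * Vᴴ * (B * Bᴴ) = B * Bᴴ := by
      have : D * Matrix.diagonal (fun i => (d i : ℂ)) = Matrix.diagonal (fun i => (d i : ℂ)) := by
        rw [hD, Matrix.diagonal_mul_diagonal]
        congr 1
        ext i
        split_ifs with h
        · rw [one_mul]
        · rw [not_not.1 h, zero_mul, Complex.ofReal_zero]
      calc _ = V * (D * (Vᴴ * V) * Matrix.diagonal (fun i => (d i : ℂ))) * Vᴴ := by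
            rw [hB]; simp only [Matrix.mul_assoc]
        _ = _ := by rw [h1, Matrix.mul_one, this, ← hB]
    generalize V * D * Vᴴ = Q at hQM
    have hz : ((1 - Q) * B) * ((1 - Q) * B)ᴴ = 0 := by
      rw [Matrix.conjTranspose_mul, Matrix.mul_assoc, ← Matrix.mul_assoc B, ← Matrix.mul_assoc,
        Matrix.sub_mul, hQM, Matrix.one_mul, sub_self, Matrix.zero_mul]
    rw [Matrix.self_mul_conjTranspose_eq_zero, Matrix.sub_mul, Matrix.one_mul, sub_eq_zero] at hz
    exact hz.symm
  · rw [Matrix.trace_mul_comm, ← Matrix.mul_assoc, h1, Matrix.one_mul, hD, Matrix.trace_diagonal,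
      ← Matrix.rank_self_mul_conjTranspose B, hH.rank_eq_card_non_zero_eigs, Fintype.card_subtype,
      ← hd, Finset.sum_boole]

lemma eq_indicator_of_sum_mul_le {r : ℕ} {μ q : Fin N → ℝ} {τ : ℝ} (hrN : r ≤ N) (hτ : 0 ≤ τ)
    (h1 : ∀ i : Fin N, (i : ℕ) < r → τ < μ i) (h2 : ∀ i : Fin N, r ≤ (i : ℕ) → μ i ≤ τ)
    (hq0 : ∀ i, 0 ≤ q i) (hq1 : ∀ i, q i ≤ 1) (hq : ∑ i, q i ≤ r) :
    (∑ i : Fin N, (if (i : ℕ) < r then 0 else μ i) ≤ ∑ i, (1 - q i) * μ i) ∧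
    (∑ i, (1 - q i) * μ i ≤ ∑ i : Fin N, (if (i : ℕ) < r then 0 else μ i) →
      ∀ i : Fin N, q i = if (i : ℕ) < r then 1 else 0) := by
  have hr : ∑ i : Fin N, (if (i : ℕ) < r then (1 : ℝ) else 0) = r := by
    rw [Finset.sum_boole, Fin.card_filter_val_lt, min_eq_right hrN]
  have hterm : ∀ i ∈ (Finset.univ : Finset (Fin N)), 0 ≤ ((if (i : ℕ) < r then (1 : ℝ) else 0) - q i) * (μ i - τ) := by
    intro i _
    split_ifs with h
    · exact mul_nonneg (sub_nonneg.2 (hq1 i)) (sub_nonneg.2 (h1 i h).le)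
    · exact mul_nonneg_of_nonpos_of_nonpos (by linarith [hq0 i]) (by linarith [h2 i (not_lt.1 h)])
  have hdiff : ∑ i, (1 - q i) * μ i - ∑ i : Fin N, (if (i : ℕ) < r then 0 else μ i) =
      ∑ i : Fin N, ((if (i : ℕ) < r then (1 : ℝ) else 0) - q i) * (μ i - τ) +
        (r - ∑ i, q i) * τ := by
    rw [← hr, ← Finset.sum_sub_distrib, ← Finset.sum_sub_distrib, Finset.sum_mul,
      ← Finset.sum_add_distrib]
    refine Finset.sum_congr rfl fun i _ => ?_
    split_ifs <;> ring
  have hpos := Finset.sum_nonneg hterm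
  have hpos' : 0 ≤ (r - ∑ i, q i) * τ := mul_nonneg (sub_nonneg.2 hq) hτ
  refine ⟨by linarith, fun hle => ?_⟩
  have hz := (Finset.sum_eq_zero_iff_of_nonneg hterm).1 (by linarith)
  have hlt : ∀ i : Fin N, (i : ℕ) < r → q i = 1 := by
    intro i hi
    have := hz i (Finset.mem_univ i)
    rw [if_pos hi, mul_eq_zero] at this
    rcases this with h | h
    · linarith
    · linarith [h1 i hi]
  have hterm' : ∀ i ∈ (Finset.univ : Finset (Fin N)), 0 ≤ q i - (if (i : ℕ) < r then (1 : ℝ) else 0) := by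
    intro i _
    split_ifs with h
    · rw [hlt i h, sub_self]
    · simpa using hq0 i
  have hs : ∑ i : Fin N, (q i - (if (i : ℕ) < r then (1 : ℝ) else 0)) ≤ 0 := by
    rw [Finset.sum_sub_distrib, hr]
    linarith
  intro i
  have := (Finset.sum_eq_zero_iff_of_nonneg hterm').1 (le_antisymm hs (Finset.sum_nonneg hterm')) i
    (Finset.mem_univ i)
  linarith

lemma norm_sub_projection_mul_sq {A Q U : Matrix (Fin N) (Fin N) ℂ} {μ : Fin N → ℝ}
    (hM : A * Aᴴ = U * Matrix.diagonal (fun i => (μ i : ℂ)) * Uᴴ)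
    (hU : U ∈ Matrix.unitaryGroup (Fin N) ℂ) (hQ : Qᴴ = Q) (hQQ : Q * Q = Q) :
    ‖A - Q * A‖ ^ 2 = ∑ i, (1 - ((Uᴴ * Q * U) i i).re) * μ i := by
  have hP : (1 - Q)ᴴ * (1 - Q) = 1 - Q := by
    rw [Matrix.conjTranspose_sub, Matrix.conjTranspose_one, hQ, Matrix.sub_mul, Matrix.mul_sub,
      Matrix.mul_sub, hQQ, Matrix.one_mul, Matrix.one_mul, Matrix.mul_one, sub_self, sub_zero]
  have h1 : (A - Q * A) = (1 - Q) * A := by rw [Matrix.sub_mul, Matrix.one_mul]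
  have h2 : ((‖A - Q * A‖ ^ 2 : ℝ) : ℂ) =
      ∑ i, (1 - (Uᴴ * Q * U) i i) * μ i := by
    rw [norm_sq_eq_trace, h1, Matrix.conjTranspose_mul, Matrix.mul_assoc, ← Matrix.mul_assoc _ _ A,
      hP, Matrix.trace_mul_comm, Matrix.mul_assoc, hM]
    calc _ = (U * (Matrix.diagonal (fun i => (μ i : ℂ)) * Uᴴ * 1)).trace -
          (Q * U * (Matrix.diagonal (fun i => (μ i : ℂ)) * Uᴴ)).trace := by
          rw [Matrix.sub_mul, Matrix.trace_sub, Matrix.one_mul, Matrix.mul_one]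
          simp only [Matrix.mul_assoc]
      _ = (Matrix.diagonal (fun i => (μ i : ℂ))).trace -
          ((Uᴴ * Q * U) * Matrix.diagonal (fun i => (μ i : ℂ))).trace := by
          rw [Matrix.trace_mul_comm, Matrix.mul_one, Matrix.mul_assoc,
            conjTranspose_mul_self_of_mem hU, Matrix.mul_one, ← Matrix.mul_assoc (Q * U),
            Matrix.trace_mul_comm _ Uᴴ]
          simp only [Matrix.mul_assoc]
      _ = _ := by
          simp only [Matrix.trace, Matrix.diag_apply, Matrix.mul_diagonal, Matrix.diagonal_apply_eq,
            ← Finset.sum_sub_distrib, sub_mul, one_mul]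
  have h3 := congrArg Complex.re h2
  rw [Complex.ofReal_re, Complex.re_sum] at h3
  rw [h3]
  refine Finset.sum_congr rfl fun i _ => ?_
  rw [Complex.re_mul_ofReal, Complex.sub_re, Complex.one_re]

lemma re_diag_eq_sum_normSq {P : Matrix (Fin N) (Fin N) ℂ} (hP : Pᴴ = P) (hPP : P * P = P)
    (i : Fin N) : (P i i).re = ∑ k, ‖P i k‖ ^ 2 := by
  have h : P i i = ∑ k, P i k * star (P i k) := by
    have h' : P * Pᴴ = P := by rw [hP, hPP]
    conv_lhs => rw [← h', Matrix.mul_apply]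
    rfl
  rw [h, Complex.re_sum]
  refine Finset.sum_congr rfl fun k _ => ?_
  rw [RCLike.star_def, Complex.mul_conj, Complex.ofReal_re, Complex.normSq_eq_norm_sq]

lemma sum_Icc_sigma_sq (A : Matrix (Fin N) (Fin N) ℂ) (r : ℕ) :
    ∑ i ∈ Finset.Icc (r + 1) N, sigma A i ^ 2 =
      ∑ i : Fin N, if (i : ℕ) < r then 0 else sigma A (i + 1) ^ 2 := by
  rw [← Finset.sum_range (n := N) (fun i => if i < r then 0 else sigma A (i + 1) ^ 2),
    Finset.sum_ite, Finset.sum_const_zero, zero_add]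
  refine (Finset.sum_bij (fun i _ => i + 1) ?_ ?_ ?_ ?_).symm
  · intro i hi
    simp at hi ⊢
    omega
  · intro i _ j _ h
    omega
  · intro i hi
    rw [Finset.mem_Icc] at hi
    exact ⟨i - 1, by simp; omega, by omega⟩
  · intro i _
    rfl

lemma exists_polynomial_spectral_projection {A U : Matrix (Fin N) (Fin N) ℂ} {μ : Fin N → ℝ}
    (hA : A = U * Matrix.diagonal (fun i => (μ i : ℂ)) * Uᴴ)
    (hU : U ∈ Matrix.unitaryGroup (Fin N) ℂ) (s : ℝ) :
    ∃ p : Polynomial ℂ, Polynomial.aeval A p =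
      U * Matrix.diagonal (fun i => if s ≤ μ i then (1 : ℂ) else 0) * Uᴴ := by
  obtain ⟨p, hp⟩ := exists_polynomial_eval_eq (Finset.univ.image fun i => (μ i : ℂ))
    (fun z => if s ≤ z.re then 1 else 0)
  refine ⟨p, ?_⟩
  rw [hA, aeval_unitary_conj hU, aeval_diagonal]
  congr 3
  ext i
  rw [hp _ (Finset.mem_image_of_mem _ (Finset.mem_univ i)), Complex.ofReal_re]

lemma sigma_antitone (A : Matrix (Fin N) (Fin N) ℂ) {i j : ℕ} (h : i ≤ j) :
    sigma A j ≤ sigma A i :=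
  LinearMap.singularValues_antitone _ (by omega)

lemma sigma_nonneg (A : Matrix (Fin N) (Fin N) ℂ) (i : ℕ) : 0 ≤ sigma A i :=
  LinearMap.singularValues_nonneg _ _

/-- The error of the best rank-`r` approximation is at most that of the truncated singular value
decomposition. -/
lemma norm_sub_sq_le_of_isBestRankApprox {r : ℕ} {A B : Matrix (Fin N) (Fin N) ℂ}
    (hA : Aᴴ = -A) (hB : IsBestRankApprox r A B) :
    ‖A - B‖ ^ 2 ≤ ∑ i ∈ Finset.Icc (r + 1) N, sigma A i ^ 2 := by
  obtain ⟨U, hU, hM⟩ := exists_unitary_diagonal_sigma A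
  have hM' : A * Aᴴ = U * Matrix.diagonal (fun i : Fin N => ((sigma A (i + 1) ^ 2 : ℝ) : ℂ)) * Uᴴ := by
    rw [← hM, hA, Matrix.mul_neg, Matrix.neg_mul]
  obtain ⟨hE, hEE⟩ := conj_diagonal_indicator hU (fun i : Fin N => (i : ℕ) < r)
  set D : Matrix (Fin N) (Fin N) ℂ := Matrix.diagonal fun i => if (i : ℕ) < r then 1 else 0 with hD
  have hrank : (U * D * Uᴴ * A).rank ≤ r := by
    calc _ ≤ (U * (D * (Uᴴ * A))).rank := by simp only [Matrix.mul_assoc, le_refl]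
      _ ≤ (D * (Uᴴ * A)).rank := Matrix.rank_mul_le_right _ _
      _ ≤ D.rank := Matrix.rank_mul_le_left _ _
      _ ≤ r := by
        rw [hD, Matrix.rank_diagonal, Fintype.card_subtype]
        calc _ = (Finset.univ.filter fun i : Fin N => (i : ℕ) < r).card := by
              congr 1
              ext i
              simp
          _ ≤ r := by rw [Fin.card_filter_val_lt]; exact min_le_right _ _
  have hle := pow_le_pow_left₀ (norm_nonneg _) (hB.2 _ hrank) 2
  rw [norm_sub_projection_mul_sq hM' hU hE hEE] at hle
  refine hle.trans_eq ?_
  rw [sum_Icc_sigma_sq]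
  refine Finset.sum_congr rfl fun i _ => ?_
  have h1 := conjTranspose_mul_self_of_mem hU
  have : Uᴴ * (U * D * Uᴴ) * U = D := by
    calc _ = Uᴴ * U * D * (Uᴴ * U) := by simp only [Matrix.mul_assoc]
      _ = _ := by rw [h1, Matrix.one_mul, Matrix.mul_one]
  rw [this, hD, Matrix.diagonal_apply_eq]
  split_ifs <;> simp

/-- Under the gap condition, the best rank-`r` approximation is unique, and it is a polynomial in
the matrix. -/
lemma exists_polynomial_of_isBestRankApprox {r : ℕ} {A : Matrix (Fin N) (Fin N) ℂ}
    (hA : Aᴴ = -A) (hrN : r ≤ N)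
    (hgap : sigma A (r + 1) ≠ 0 → sigma A (r + 1) < sigma A r) :
    ∃ p : Polynomial ℂ, ∀ B, IsBestRankApprox r A B → B = Polynomial.aeval A p := by
  by_cases hz : sigma A (r + 1) = 0
  · refine ⟨Polynomial.X, fun B hB => ?_⟩
    have h := norm_sub_sq_le_of_isBestRankApprox hA hB
    rw [Finset.sum_eq_zero] at h
    · have h0 : ‖A - B‖ = 0 := pow_eq_zero_iff two_ne_zero |>.1 (le_antisymm h (sq_nonneg _))
      rw [Polynomial.aeval_X, ← sub_eq_zero.1 (norm_eq_zero.1 h0)]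
    · intro i hi
      have h1 := sigma_antitone A (Finset.mem_Icc.1 hi).1
      rw [hz] at h1
      rw [le_antisymm h1 (sigma_nonneg A i), zero_pow two_ne_zero]
  have hlt := hgap hz
  obtain ⟨U, hU, hM⟩ := exists_unitary_diagonal_sigma A
  obtain ⟨p, hp⟩ := exists_polynomial_spectral_projection hM hU (sigma A r ^ 2)
  refine ⟨p.comp (-Polynomial.X ^ 2) * Polynomial.X, fun B hB => ?_⟩
  have hAA : Aᴴ * A = -A ^ 2 := by rw [hA, Matrix.neg_mul, sq]
  rw [map_mul, Polynomial.aeval_comp, map_neg, map_pow, Polynomial.aeval_X, ← hAA, hp]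
  have hM' : A * Aᴴ = U * Matrix.diagonal (fun i : Fin N => ((sigma A (i + 1) ^ 2 : ℝ) : ℂ)) * Uᴴ := by
    rw [← hM, hA, Matrix.mul_neg, Matrix.neg_mul]
  obtain ⟨Q, hQ, hQQ, hQB, htr⟩ := exists_projection B
  have hU1 := conjTranspose_mul_self_of_mem hU
  have hU2 := mul_conjTranspose_self_of_mem hU
  set P := Uᴴ * Q * U with hPdef
  have hP : Pᴴ = P := by
    simp only [hPdef, Matrix.conjTranspose_mul, Matrix.conjTranspose_conjTranspose, hQ,
      Matrix.mul_assoc]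
  have hPP : P * P = P := by
    calc _ = Uᴴ * (Q * (U * Uᴴ) * Q) * U := by simp only [hPdef, Matrix.mul_assoc]
      _ = _ := by rw [hU2, Matrix.mul_one, hQQ]
  have hdiag := re_diag_eq_sum_normSq hP hPP
  have hq0 : ∀ i, 0 ≤ (P i i).re := fun i => by
    rw [hdiag]
    exact Finset.sum_nonneg fun _ _ => by positivity
  have hsq : ∀ i, (P i i).re ^ 2 ≤ (P i i).re := fun i => by
    calc _ ≤ ‖P i i‖ ^ 2 := by
          rw [← sq_abs]
          gcongr
          exact Complex.abs_re_le_norm _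
      _ ≤ _ := by
          conv_rhs => rw [hdiag]
          exact Finset.single_le_sum (f := fun k => ‖P i k‖ ^ 2) (fun _ _ => by positivity)
            (Finset.mem_univ i)
  have hq1 : ∀ i, (P i i).re ≤ 1 := fun i => by nlinarith [hsq i, hq0 i]
  have hsum : ∑ i, (P i i).re ≤ r := by
    have h : P.trace = B.rank := by
      rw [hPdef, Matrix.mul_assoc, Matrix.trace_mul_comm, Matrix.mul_assoc, hU2, Matrix.mul_one, htr]
    have h' := congrArg Complex.re h
    rw [Matrix.trace, Complex.re_sum, Complex.natCast_re] at h'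
    simp only [Matrix.diag_apply] at h'
    rw [h']
    exact_mod_cast hB.1
  have hweights := eq_indicator_of_sum_mul_le (μ := fun i : Fin N => sigma A (i + 1) ^ 2)
    (q := fun i => (P i i).re) (τ := sigma A (r + 1) ^ 2) hrN (sq_nonneg _)
    (fun i hi => pow_lt_pow_left₀ (hlt.trans_le (sigma_antitone A (by omega))) (sigma_nonneg A _)
      two_ne_zero)
    (fun i hi => pow_le_pow_left₀ (sigma_nonneg A _) (sigma_antitone A (by omega)) 2) hq0 hq1 hsum
  have hpyth : ‖A - B‖ ^ 2 = ‖A - Q * A‖ ^ 2 + ‖Q * A - B‖ ^ 2 := by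
    rw [← norm_add_sq_of_trace_eq_zero, sub_add_sub_cancel]
    have : (A - Q * A)ᴴ * (Q * A - B) = 0 := by
      rw [Matrix.conjTranspose_sub, Matrix.conjTranspose_mul, hQ, Matrix.sub_mul, Matrix.mul_assoc,
        Matrix.mul_sub, Matrix.mul_sub, Matrix.mul_sub, hQB, ← Matrix.mul_assoc Q, hQQ, sub_self]
    rw [this, Matrix.trace_zero]
  have hle := norm_sub_sq_le_of_isBestRankApprox hA hB
  rw [hpyth, norm_sub_projection_mul_sq hM' hU hQ hQQ, sum_Icc_sigma_sq] at hle
  have hq := hweights.2 (by nlinarith [sq_nonneg ‖Q * A - B‖])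
  have hB' : B = Q * A := by
    have h : ‖Q * A - B‖ ^ 2 ≤ 0 := by linarith [hweights.1]
    have h0 : ‖Q * A - B‖ = 0 := pow_eq_zero_iff two_ne_zero |>.1 (le_antisymm h (sq_nonneg _))
    exact (sub_eq_zero.1 (norm_eq_zero.1 h0)).symm
  have hPD : P = Matrix.diagonal
      fun i : Fin N => if sigma A r ^ 2 ≤ sigma A (i + 1) ^ 2 then (1 : ℂ) else 0 := by
    have hiff : ∀ i : Fin N, sigma A r ^ 2 ≤ sigma A (i + 1) ^ 2 ↔ (i : ℕ) < r := by
      intro i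
      constructor
      · intro h
        by_contra! hcon
        have h1 : sigma A (i + 1) ≤ sigma A (r + 1) := sigma_antitone A (by omega)
        exact absurd h (not_le.2 (pow_lt_pow_left₀ (h1.trans_lt hlt) (sigma_nonneg A _) two_ne_zero))
      · intro h
        exact pow_le_pow_left₀ (sigma_nonneg A _) (sigma_antitone A (by omega)) 2
    have hoff : ∀ i k, k ≠ i → P i k = 0 := by
      intro i k hk
      have h1 := hdiag i
      rw [← Finset.add_sum_erase _ _ (Finset.mem_univ i)] at h1
      have h2 : ‖P i k‖ ^ 2 ≤ ∑ k ∈ Finset.univ.erase i, ‖P i k‖ ^ 2 :=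
        Finset.single_le_sum (f := fun k => ‖P i k‖ ^ 2) (fun _ _ => by positivity)
          (Finset.mem_erase.2 ⟨hk, Finset.mem_univ k⟩)
      have h3 : (P i i).re = (P i i).re ^ 2 := by
        rw [hq i]
        split_ifs <;> norm_num
      have h4 : (P i i).re ^ 2 ≤ ‖P i i‖ ^ 2 := by
        rw [← sq_abs]
        gcongr
        exact Complex.abs_re_le_norm _
      have h5 : ‖P i k‖ ^ 2 = 0 := le_antisymm (by linarith) (sq_nonneg _)
      exact norm_eq_zero.1 (pow_eq_zero_iff two_ne_zero |>.1 h5)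
    ext i k
    rw [Matrix.diagonal_apply]
    by_cases h : i = k
    · subst h
      rw [if_pos rfl]
      have him : (P i i).im = 0 := by
        have h1 := congrFun (congrFun hP i) i
        rw [Matrix.conjTranspose_apply] at h1
        exact Complex.conj_eq_iff_im.1 h1
      apply Complex.ext
      · rw [hq i, apply_ite Complex.re]
        exact (if_congr (hiff i) rfl rfl).symm
      · rw [him]
        split_ifs <;> rfl
    · rw [if_neg h, hoff i k (Ne.symm h)]
  rw [← hPD, hB']
  congr 1
  calc Q = U * Uᴴ * Q * (U * Uᴴ) := by rw [hU2, Matrix.one_mul, Matrix.mul_one]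
    _ = _ := by simp only [hPdef, Matrix.mul_assoc]

/-! ### Isospectrality of the flow -/

lemma sum_eval_eq_card_filter (d e : Fin N → ℂ) (a : ℂ) :
    ∃ p : Polynomial ℂ, ∑ i, p.eval (d i) = (Finset.univ.filter fun i => d i = a).card ∧
      ∑ i, p.eval (e i) = (Finset.univ.filter fun i => e i = a).card := by
  obtain ⟨p, hp⟩ := exists_polynomial_eval_eq (Finset.univ.image d ∪ Finset.univ.image e)
    (fun z => if z = a then 1 else 0)
  refine ⟨p, ?_, ?_⟩ <;> rw [← Finset.sum_boole] <;> refine Finset.sum_congr rfl fun i _ => hp _ ?_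
  · exact Finset.mem_union_left _ (Finset.mem_image_of_mem _ (Finset.mem_univ i))
  · exact Finset.mem_union_right _ (Finset.mem_image_of_mem _ (Finset.mem_univ i))

lemma trace_aeval_unitary_conj_diagonal {U : Matrix (Fin N) (Fin N) ℂ}
    (hU : U ∈ Matrix.unitaryGroup (Fin N) ℂ) (d : Fin N → ℂ) (p : Polynomial ℂ) :
    (Polynomial.aeval (U * Matrix.diagonal d * Uᴴ) p).trace = ∑ i, p.eval (d i) := by
  rw [aeval_unitary_conj hU, Matrix.trace_mul_comm, ← Matrix.mul_assoc,
    conjTranspose_mul_self_of_mem hU, Matrix.one_mul, aeval_diagonal, Matrix.trace_diagonal]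

lemma isHermitian_I_smul {A : Matrix (Fin N) (Fin N) ℂ} (hA : Aᴴ = -A) :
    (Complex.I • A).IsHermitian := by
  rw [Matrix.IsHermitian, Matrix.conjTranspose_smul, hA]
  simp

/-- Skew-Hermitian matrices with the same traces of polynomials are unitarily similar. -/
lemma exists_unitary_conj_of_trace_aeval_eq {A B : Matrix (Fin N) (Fin N) ℂ} (hA : Aᴴ = -A)
    (hB : Bᴴ = -B)
    (h : ∀ p : Polynomial ℂ, (Polynomial.aeval A p).trace = (Polynomial.aeval B p).trace) :
    ∃ R ∈ Matrix.unitaryGroup (Fin N) ℂ, B = R * A * Rᴴ := by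
  have hA' := isHermitian_I_smul hA
  have hB' := isHermitian_I_smul hB
  obtain ⟨U, hU, hUA⟩ := exists_unitary_diagonal_of_isHermitian hA'
  obtain ⟨V, hV, hVB⟩ := exists_unitary_diagonal_of_isHermitian hB'
  have hscale : ∀ (C : Matrix (Fin N) (Fin N) ℂ) (p : Polynomial ℂ),
      Polynomial.aeval (Complex.I • C) p =
        Polynomial.aeval C (p.comp (Polynomial.C Complex.I * Polynomial.X)) := fun C p => by
    rw [Polynomial.aeval_comp, map_mul, Polynomial.aeval_C, Polynomial.aeval_X,
      Algebra.algebraMap_eq_smul_one, smul_one_mul]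
  have htr : ∀ p : Polynomial ℂ, ∑ i, p.eval (hA'.eigenvalues i : ℂ) =
      ∑ i, p.eval (hB'.eigenvalues i : ℂ) := fun p => by
    rw [← trace_aeval_unitary_conj_diagonal hU, ← trace_aeval_unitary_conj_diagonal hV, ← hUA,
      ← hVB, hscale, hscale, h]
  have hroots : (Complex.I • A).charpoly.roots = (Complex.I • B).charpoly.roots := by
    rw [hA'.roots_charpoly_eq_eigenvalues, hB'.roots_charpoly_eq_eigenvalues]
    ext a
    rw [Multiset.count_map, Multiset.count_map]
    obtain ⟨p, h1, h2⟩ := sum_eval_eq_card_filter (fun i => (hA'.eigenvalues i : ℂ))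
      (fun i => (hB'.eigenvalues i : ℂ)) a
    rw [htr p, h2, Nat.cast_inj] at h1
    simpa [Finset.card_def, eq_comm] using h1.symm
  have heig : hA'.eigenvalues = hB'.eigenvalues := by
    rw [Matrix.IsHermitian.eigenvalues_eq_eigenvalues_iff,
      hA'.splits_charpoly.eq_prod_roots_of_monic (Matrix.charpoly_monic _),
      hB'.splits_charpoly.eq_prod_roots_of_monic (Matrix.charpoly_monic _), hroots]
  have hU1 := conjTranspose_mul_self_of_mem hU
  refine ⟨V * Uᴴ, mul_mem hV (Unitary.star_mem hU), ?_⟩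
  have key : Complex.I • B = Complex.I • (V * Uᴴ * A * (V * Uᴴ)ᴴ) := by
    rw [← Matrix.smul_mul, ← Matrix.mul_smul, hVB, ← heig]
    conv_rhs => rw [hUA]
    rw [Matrix.conjTranspose_mul, Matrix.conjTranspose_conjTranspose]
    calc _ = V * (1 * Matrix.diagonal (fun i => (hA'.eigenvalues i : ℂ)) * 1) * Vᴴ := by
          rw [Matrix.one_mul, Matrix.mul_one]
      _ = _ := by rw [← hU1]; simp only [Matrix.mul_assoc]
  exact smul_right_injective _ Complex.I_ne_zero key

lemma bracketN_add_right (P A B : Matrix (Fin N) (Fin N) ℂ) :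
    bracketN P (A + B) = bracketN P A + bracketN P B := by
  rw [bracketN, bracketN, bracketN, ← smul_add, Matrix.mul_add, Matrix.add_mul]
  congr 1
  abel

lemma bracketN_mul_right (P A B : Matrix (Fin N) (Fin N) ℂ) :
    bracketN P (A * B) = bracketN P A * B + A * bracketN P B := by
  rw [bracketN, bracketN, bracketN, Matrix.smul_mul, Matrix.mul_smul, ← smul_add]
  congr 1
  noncomm_ring

lemma bracketN_smul_right (P A : Matrix (Fin N) (Fin N) ℂ) (c : ℂ) :
    bracketN P (c • A) = c • bracketN P A := by
  rw [bracketN, bracketN, Matrix.smul_mul, Matrix.mul_smul, ← smul_sub, smul_comm]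

lemma bracketN_one_right (P : Matrix (Fin N) (Fin N) ℂ) : bracketN P 1 = 0 := by
  rw [bracketN, Matrix.mul_one, Matrix.one_mul, sub_self, smul_zero]

lemma trace_bracketN (P A : Matrix (Fin N) (Fin N) ℂ) : (bracketN P A).trace = 0 := by
  rw [bracketN, Matrix.trace_smul, Matrix.trace_sub, Matrix.trace_mul_comm, sub_self, smul_zero]

attribute [local instance] Matrix.frobeniusNormedRing Matrix.frobeniusNormedAlgebra in
lemma hasDerivWithinAt_matrix_mul {A B : ℝ → Matrix (Fin N) (Fin N) ℂ}
    {A' B' : Matrix (Fin N) (Fin N) ℂ} {s : Set ℝ} {t : ℝ} (hA : HasDerivWithinAt A A' s t)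
    (hB : HasDerivWithinAt B B' s t) :
    HasDerivWithinAt (fun x => A x * B x) (A' * B t + A t * B') s t :=
  HasDerivWithinAt.mul hA hB

/-- A polynomial of a solution of a Lax equation solves the same Lax equation. -/
lemma hasDerivWithinAt_aeval {W : ℝ → Matrix (Fin N) (Fin N) ℂ} {P : Matrix (Fin N) (Fin N) ℂ}
    {s : Set ℝ} {t : ℝ} (hW : HasDerivWithinAt W (-bracketN P (W t)) s t) (p : Polynomial ℂ) :
    HasDerivWithinAt (fun x => Polynomial.aeval (W x) p)
      (-bracketN P (Polynomial.aeval (W t) p)) s t := by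
  induction p using Polynomial.induction_on' with
  | add p q hp hq =>
    simp only [map_add, bracketN_add_right, neg_add]
    exact hp.add hq
  | monomial n a =>
    simp only [Polynomial.aeval_monomial, Algebra.algebraMap_eq_smul_one, smul_one_mul,
      bracketN_smul_right, ← smul_neg]
    refine HasDerivWithinAt.const_smul a ?_
    induction n with
    | zero =>
      simp only [pow_zero, bracketN_one_right, neg_zero]
      exact hasDerivWithinAt_const _ _ _
    | succ n ih =>
      have h := hasDerivWithinAt_matrix_mul ih hW
      rw [Matrix.neg_mul, Matrix.mul_neg, ← neg_add, ← bracketN_mul_right, ← pow_succ] at h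
      simp only [pow_succ] at h ⊢
      exact h

lemma hasDerivWithinAt_trace {A : ℝ → Matrix (Fin N) (Fin N) ℂ} {A' : Matrix (Fin N) (Fin N) ℂ}
    {s : Set ℝ} {t : ℝ} (hA : HasDerivWithinAt A A' s t) :
    HasDerivWithinAt (fun x => (A x).trace) A'.trace s t :=
  ((Matrix.traceLinearMap (Fin N) ℝ ℂ).toContinuousLinearMap.hasFDerivAt
    (x := A t)).comp_hasDerivWithinAt t hA

lemma hasDerivWithinAt_Ici_of_Icc {E : Type*} [NormedAddCommGroup E] [NormedSpace ℝ E] {f : ℝ → E}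
    {f' : E} {a b t : ℝ} (h : HasDerivWithinAt f f' (Set.Icc a b) t) (ht : t ∈ Set.Ico a b) :
    HasDerivWithinAt f f' (Set.Ici t) t :=
  h.mono_of_mem_nhdsWithin (Icc_mem_nhdsGE_of_mem ht)

lemma IsSolution.zero_mem {T t : ℝ} (ht : t ∈ Set.Icc 0 T) : (0 : ℝ) ∈ Set.Icc 0 T :=
  ⟨le_rfl, ht.1.trans ht.2⟩

/-- The solution stays on the co-adjoint orbit of its initial value. -/
lemma IsSolution.mem_orbit {T : ℝ} {W : ℝ → Matrix (Fin N) (Fin N) ℂ}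
    {W₀ : Matrix (Fin N) (Fin N) ℂ} (hW : IsSolution T W W₀) {t : ℝ} (ht : t ∈ Set.Icc 0 T) :
    W t ∈ orbit W₀ := by
  have h0 := IsSolution.zero_mem ht
  obtain ⟨P, hP⟩ := hW.equation
  rw [← hW.initial]
  refine exists_unitary_conj_of_trace_aeval_eq (hW.mem_u 0 h0) (hW.mem_u t ht) fun p => ?_
  have hder : ∀ x ∈ Set.Icc 0 T, HasDerivWithinAt (fun x => (Polynomial.aeval (W x) p).trace) 0
      (Set.Icc 0 T) x := fun x hx => by
    have h := hasDerivWithinAt_trace (hasDerivWithinAt_aeval (hP x hx).2 p)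
    rwa [Matrix.trace_neg, trace_bracketN, neg_zero] at h
  exact (constant_of_has_deriv_right_zero (fun x hx => (hder x hx).continuousWithinAt)
    (fun x hx => hasDerivWithinAt_Ici_of_Icc (hder x ⟨hx.1, hx.2.le⟩) hx) t ht).symm

/-! ### The error bound -/

lemma hbar_pos (hN : 2 ≤ N) : 0 < hbar N := by
  have : (2 : ℝ) ≤ N := by exact_mod_cast hN
  exact div_pos two_pos (Real.sqrt_pos.2 (by nlinarith))

lemma norm_bracketN_le (A B : Matrix (Fin N) (Fin N) ℂ) (hN : 2 ≤ N) :
    ‖bracketN A B‖ ≤ (hbar N)⁻¹ * (2 * ‖A‖ * ‖B‖) := by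
  have h := inv_pos.2 (hbar_pos hN)
  rw [bracketN, norm_smul, Real.norm_of_nonneg h.le]
  gcongr
  have h1 := Matrix.frobenius_norm_mul A B
  have h2 := Matrix.frobenius_norm_mul B A
  linarith [norm_sub_le (A * B) (B * A)]

lemma bracketN_add_smul_one (Q A : Matrix (Fin N) (Fin N) ℂ) (d : ℂ) :
    -bracketN (Q + d • (1 : Matrix (Fin N) (Fin N) ℂ)) A = bracketN A Q := by
  rw [bracketN, bracketN, ← smul_neg]
  congr 1
  rw [Matrix.add_mul, Matrix.mul_add, Matrix.smul_mul, Matrix.mul_smul, Matrix.one_mul,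
    Matrix.mul_one]
  abel

lemma bracketN_sub_right (P A B : Matrix (Fin N) (Fin N) ℂ) :
    bracketN P (A - B) = bracketN P A - bracketN P B := by
  rw [bracketN, bracketN, bracketN, ← smul_sub, Matrix.mul_sub, Matrix.sub_mul]
  congr 1
  abel

/-- Polynomials of a solution of the Zeitlin model are transported by its stream matrix. -/
lemma IsSolution.hasDerivWithinAt_aeval {T : ℝ} {W : ℝ → Matrix (Fin N) (Fin N) ℂ}
    {W₀ : Matrix (Fin N) (Fin N) ℂ} (hW : IsSolution T W W₀) (p : Polynomial ℂ) {t : ℝ}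
    (ht : t ∈ Set.Icc 0 T) :
    HasDerivWithinAt (fun x => Polynomial.aeval (W x) p)
      (bracketN (Polynomial.aeval (W t) p) (invLaplacian N (W t))) (Set.Icc 0 T) t := by
  obtain ⟨P, hP⟩ := hW.equation
  have h := Zeitlin.hasDerivWithinAt_aeval (hP t ht).2 p
  obtain ⟨d, hd⟩ := exists_eq_invLaplacian_add (hP t ht).1
  rwa [hd, bracketN_add_smul_one] at h

lemma IsSolution.hasDerivWithinAt {T : ℝ} {W : ℝ → Matrix (Fin N) (Fin N) ℂ}
    {W₀ : Matrix (Fin N) (Fin N) ℂ} (hW : IsSolution T W W₀) {t : ℝ} (ht : t ∈ Set.Icc 0 T) :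
    HasDerivWithinAt W (vectorField (W t)) (Set.Icc 0 T) t := by
  have h := hW.hasDerivWithinAt_aeval Polynomial.X ht
  simp only [Polynomial.aeval_X] at h
  exact h

lemma IsBestRankApprox.conj {r : ℕ} {A B R : Matrix (Fin N) (Fin N) ℂ}
    (hR : R ∈ Matrix.unitaryGroup (Fin N) ℂ) (h : IsBestRankApprox r (R * A * Rᴴ) B) :
    IsBestRankApprox r A (Rᴴ * B * R) := by
  have h1 := conjTranspose_mul_self_of_mem hR
  have h2 := mul_conjTranspose_self_of_mem hR
  have hrank : ∀ S C S' : Matrix (Fin N) (Fin N) ℂ, (S * C * S').rank ≤ C.rank := fun S C S' =>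
    (Matrix.rank_mul_le_left _ _).trans (Matrix.rank_mul_le_right _ _)
  have hcancel : ∀ C : Matrix (Fin N) (Fin N) ℂ, ‖R * A * Rᴴ - R * C * Rᴴ‖ = ‖A - C‖ := fun C => by
    rw [← Matrix.sub_mul, ← Matrix.mul_sub, norm_unitary_conj hR]
  refine ⟨(hrank _ _ _).trans h.1, fun C hC => ?_⟩
  rw [← hcancel, ← hcancel]
  have : R * (Rᴴ * B * R) * Rᴴ = B := by
    calc _ = R * Rᴴ * B * (R * Rᴴ) := by simp only [Matrix.mul_assoc]
      _ = _ := by rw [h2, Matrix.one_mul, Matrix.mul_one]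
  rw [this]
  exact h.2 _ ((hrank _ _ _).trans hC)

lemma gronwallBound_zero_eq {K ε x : ℝ} (hK : K ≠ 0) :
    gronwallBound 0 K ε x = ε / K * (Real.exp (K * x) - 1) := by
  simp [gronwallBound_of_K_ne_0 hK]

end

end Zeitlin

open Zeitlin in
/-- The vorticity matrix `W` solves the Zeitlin model from `W₀ ∈ 𝔰𝔲(N)`, and `Y` solves it from the
best rank-`r` approximation `Y₀` of `W₀`, which the hypothesis `hgap` makes unique. The constant `K`
is a Lipschitz constant of the vector field on the co-adjoint orbit of `Y₀`. -/
theorem mainTheorem1 (N r : ℕ) (hN : 2 ≤ N) (hr : 1 ≤ r) (hrN : r ≤ N) (T : ℝ)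
    (W₀ Y₀ : Matrix (Fin N) (Fin N) ℂ) (hW₀ : W₀ ∈ Zeitlin.su N)
    (hgap : Zeitlin.sigma W₀ (r + 1) ≠ 0 → Zeitlin.sigma W₀ (r + 1) < Zeitlin.sigma W₀ r)
    (hY₀ : Zeitlin.IsBestRankApprox r W₀ Y₀)
    (W Y : ℝ → Matrix (Fin N) (Fin N) ℂ)
    (hW : Zeitlin.IsSolution T W W₀) (hY : Zeitlin.IsSolution T Y Y₀)
    (K : NNReal) (hK : 0 < K)
    (hLip : LipschitzOnWith K (Zeitlin.vectorField (N := N)) (Zeitlin.orbit Y₀))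
    (t : ℝ) (ht : t ∈ Set.Ioc 0 T)
    (Wr : Matrix (Fin N) (Fin N) ℂ) (hWr : Zeitlin.IsBestRankApprox r (W t) Wr) :
    ‖Y t - Wr‖ ≤ ‖Y₀‖ / (Zeitlin.hbar N * K) * (Real.exp (K * t) - 1)
      * √(∑ i ∈ Finset.Icc (r + 1) N, Zeitlin.sigma W₀ i ^ 2) := by

  have htI : t ∈ Set.Icc 0 T := ⟨ht.1.le, ht.2⟩
  have h0I := IsSolution.zero_mem htI
  obtain ⟨p, hp⟩ := exists_polynomial_of_isBestRankApprox hW₀.1 hrN hgap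
  have hpY : Polynomial.aeval W₀ p = Y₀ := (hp Y₀ hY₀).symm
  let Z : ℝ → Matrix (Fin N) (Fin N) ℂ := fun x => Polynomial.aeval (W x) p
  have hZ : ∀ x ∈ Set.Icc 0 T, ∃ R ∈ Matrix.unitaryGroup (Fin N) ℂ,
      W x = R * W₀ * R.conjTranspose ∧ Z x = R * Y₀ * R.conjTranspose := fun x hx => by
    obtain ⟨R, hR, hWx⟩ := hW.mem_orbit hx
    exact ⟨R, hR, hWx, by simp only [Z]; rw [hWx, aeval_unitary_conj hR, hpY]⟩
  have hZt : Wr = Z t := by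
    obtain ⟨R, hR, hWt, hZ⟩ := hZ t htI
    rw [hWt] at hWr
    have h := hp _ (hWr.conj hR)
    rw [hpY] at h
    have h2 := mul_conjTranspose_self_of_mem hR
    rw [hZ, ← h]
    calc Wr = R * R.conjTranspose * Wr * (R * R.conjTranspose) := by
          rw [h2, Matrix.one_mul, Matrix.mul_one]
      _ = _ := by simp only [Matrix.mul_assoc]
  set ε := √(∑ i ∈ Finset.Icc (r + 1) N, sigma W₀ i ^ 2) with hε
  have hZW : ∀ x ∈ Set.Icc 0 T, ‖W x - Z x‖ ≤ ε ∧ ‖Z x‖ = ‖Y₀‖ := fun x hx => by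
    obtain ⟨R, hR, hWx, hZx⟩ := hZ x hx
    rw [hWx, hZx, ← Matrix.sub_mul, ← Matrix.mul_sub, norm_unitary_conj hR, norm_unitary_conj hR]
    exact ⟨Real.le_sqrt_of_sq_le (norm_sub_sq_le_of_isBestRankApprox hW₀.1 hY₀), rfl⟩
  have hder : ∀ x ∈ Set.Icc 0 T, HasDerivWithinAt (fun x => Y x - Z x)
      (vectorField (Y x) - bracketN (Z x) (invLaplacian N (W x))) (Set.Icc 0 T) x := fun x hx =>
    (hY.hasDerivWithinAt hx).sub (hW.hasDerivWithinAt_aeval p hx)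
  have hbound : ∀ x ∈ Set.Icc 0 T,
      ‖vectorField (Y x) - bracketN (Z x) (invLaplacian N (W x))‖ ≤
        K * ‖Y x - Z x‖ + ‖Y₀‖ / hbar N * ε := fun x hx => by
    obtain ⟨R, hR, -, hZx⟩ := hZ x hx
    have h1 : ‖vectorField (Y x) - vectorField (Z x)‖ ≤ K * ‖Y x - Z x‖ :=
      hLip.norm_sub_le (hY.mem_orbit hx) ⟨R, hR, hZx⟩
    have h2 : ‖bracketN (Z x) (invLaplacian N (W x - Z x))‖ ≤ ‖Y₀‖ / hbar N * ε := by
      have hpos := inv_pos.2 (hbar_pos hN)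
      obtain ⟨h3, h4⟩ := hZW x hx
      calc _ ≤ (hbar N)⁻¹ * (2 * ‖Z x‖ * ‖invLaplacian N (W x - Z x)‖) := norm_bracketN_le _ _ hN
        _ ≤ (hbar N)⁻¹ * (2 * ‖Y₀‖ * (1 / 2 * ε)) := by
          rw [h4]
          gcongr
          exact (norm_invLaplacian_le _).trans (by gcongr)
        _ = _ := by ring
    have h5 : vectorField (Y x) - bracketN (Z x) (invLaplacian N (W x)) =
        (vectorField (Y x) - vectorField (Z x)) - bracketN (Z x) (invLaplacian N (W x - Z x)) := by
      rw [invLaplacian, spectralOp_sub, bracketN_sub_right, vectorField, vectorField, invLaplacian]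
      abel
    rw [h5]
    exact (norm_sub_le _ _).trans (add_le_add h1 h2)
  have hinit : ‖Y 0 - Z 0‖ ≤ 0 := by
    simp only [Z]
    rw [hY.initial, hW.initial, hpY, sub_self, norm_zero]
  have hgron := norm_le_gronwallBound_of_norm_deriv_right_le
    (fun x hx => (hder x hx).continuousWithinAt)
    (fun x hx => hasDerivWithinAt_Ici_of_Icc (hder x ⟨hx.1, hx.2.le⟩) hx) hinit
    (fun x hx => hbound x ⟨hx.1, hx.2.le⟩) t htI
  rw [gronwallBound_zero_eq (by exact_mod_cast hK.ne'), sub_zero] at hgron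
  rw [hZt]
  refine hgron.trans_eq ?_
  rw [← div_div]
  ring
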